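/- Let $\mathbb{F}$ be an algebraically closed field of characteristic $0$, let $\Lambda(n)$ be the Grassmann superalgebra over $\mathbb{F}$ on odd generators $\xi_1,\dots,\xi_n$, put $\partial_i=\partial/\partial\xi_i$ and $x^u=\xi_{i_1}\cdots\xi_{i_k}$, $|u|=k$, for $u=(i_1<\dots<i_k)$. With the supercommutator as bracket, consider the following Lie superalgebras of superderivations of $\Lambda(n)$, together with subspaces $L_k$ and a Cartan subalgebra $\mathfrak h$ of $L_0$. * $W(n)=\operatorname{der}\Lambda(n)$, $n\ge 3$: $L_k=\operatorname{span}\{x^u\partial_i: |u|=k+1\}$, $\mathfrak h=\operatorname{span}\{\xi_i\partial_i\}$, $t=n-1$. * $S(n)=\bigoplus_{k=-1}^{n-2}L_k$, $n\ge 4$: $L_k=\operatorname{span}\{D_{ij}(x^u): |u|=k+2,\ 1\le i,j\le n\}$ with $D_{ij}(f)=\partial_i(f)\partial_j+\partial_j(f)\partial_i$, $\mathfrak h=\operatorname{span}\{\xi_i\partial_i-\xi_j\partial_j\}$, $t=n-2$. * $\widetilde S(2m)=\bigoplus_{k=-1}^{2m-2}L_k$, $m\ge 2$: $L_{-1}=\operatorname{span}\{(1+\xi_1\cdots\xi_{2m})\partial_j: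 1\le j\le 2m\}$, $L_k=S(2m)_k$ for $k\ge 0$, $\mathfrak h$ as for $S(2m)$, $t=1$. * $H(n)=\bigoplus_{k=-1}^{n-3}L_k$, $n\ge 5$: $L_k=\operatorname{span}\{D_H(x^u): |u|=k+2\}$ with $D_H(x^u)=(-1)^{|u|}\sum_i\partial_i(x^u)\partial_{i'}$, where, with $m=\lfloor n/2\rfloor$, $i\mapsto i'$ is the involution of $\{1,\dots,n\}$ exchanging $i$ and $i+m$ for $1\le i\le m$ and fixing $n$ if $n$ is odd; $\mathfrak h=\operatorname{span}\{\xi_i\partial_i-\xi_{i'}\partial_{i'}: 1\le i\le m\}$, $t=1$. For elements $a,b$ let $\langle a,b\rangle$ be the smallest linear subspace (not required to be $\mathbb{Z}_2$-graded) that contains $a$ and $b$ and is closed under the bracket. For a finite set $\Phi\subset\mathfrak h^*$ put $\Omega_\Phi=\{h\in\mathfrak h: f(h)\ne g(h)\text{ for all distinct } f,g\in\Phi\}$. Then every such $L$ is generated by $2$ elements. More precisely, let $r=2$ if $L=H(6)$ and $r=1$ otherwise. There are nonzero weight vectors (relative to $\mathfrak h$) $x_{-1}\in L_{-1}$ and $y_1,\dots,y_r\in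 L_t$, of pairwise distinct weights, an element $x_0\in L_0$, and a finite set $\Phi\subset\mathfrak h^*$ with $\Omega_\Phi\neq\emptyset$, such that for every $h\in\Omega_\Phi$ $$\langle x_0,h\rangle=L_0\qquad\text{and}\qquad \langle x_{-1}+x_0+y_1+\dots+y_r,\ h\rangle=L .$$ -/

import Mathlib

noncomputable section

namespace CartanSuper

/-- The Grassmann algebra `Λ(n)` over `F`. -/
abbrev Grassmann (F : Type*) [Field F] (n : ℕ) : Type _ := ExteriorAlgebra F (Fin n → F)

variable (F : Type*) [Field F] {n : ℕ}

/-- The even part (`p = 0`) and the odd part (`p = 1`) of `Λ(n)`. -/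
def part (n : ℕ) (p : ZMod 2) : Submodule F (Grassmann F n) :=
  CliffordAlgebra.evenOdd (0 : QuadraticForm F (Fin n → F)) p

/-- The generators `ξ_i` of `Λ(n)`. -/
def xi (i : Fin n) : Grassmann F n := ExteriorAlgebra.ι F (Pi.single i 1)

/-- `x^u = ξ_{i_1} ⋯ ξ_{i_k}` for a shuffle `u = (i_1 < ⋯ < i_k)`, given as a finite set. -/
def mono (u : Finset (Fin n)) : Grassmann F n := ((u.sort (· ≤ ·)).map (xi F)).prod

/-- The derivative `∂/∂ξ_i`: the left superderivation of `Λ(n)` with `ξ_j ↦ δ_{ij}`. -/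
def pd (i : Fin n) : Module.End F (Grassmann F n) :=
  CliffordAlgebra.contractLeft (Q := (0 : QuadraticForm F (Fin n → F))) (LinearMap.proj i)

/-- The operator `f ∂/∂ξ_i`. -/
def fpd (f : Grassmann F n) (i : Fin n) : Module.End F (Grassmann F n) :=
  LinearMap.mulLeft F f * pd F i

/-- The parity automorphism `a ↦ (-1)^p a` (for `a` of parity `p`) of `Λ(n)`. -/
def parity (n : ℕ) : Module.End F (Grassmann F n) :=
  (CliffordAlgebra.involute (Q := (0 : QuadraticForm F (Fin n → F)))).toLinearMap

variable {F}

/-- The component of parity `p` of an operator on `Λ(n)`, so that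
`A = component 0 A + component 1 A` (the characteristic is not `2`). -/
def component (p : ZMod 2) (A : Module.End F (Grassmann F n)) : Module.End F (Grassmann F n) :=
  (2⁻¹ : F) • (A + (-1 : F) ^ p.val • (parity F n * A * parity F n))

/-- The supercommutator `[A, B] = AB - (-1)^{|A||B|} BA`, extended bilinearly from homogeneous
operators to all operators on `Λ(n)`. -/
def superBracket (A B : Module.End F (Grassmann F n)) : Module.End F (Grassmann F n) :=
  ∑ p : ZMod 2, ∑ q : ZMod 2,
    (component p A * component q B - (-1 : F) ^ (p * q).val • (component q B * component p A))

/-- The subalgebra generated by a set: the smallest subspace containing it and closed under the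
superbracket. It is not required to be compatible with the parity. -/
def generated (X : Set (Module.End F (Grassmann F n))) :
    Submodule F (Module.End F (Grassmann F n)) :=
  sInf {N | X ⊆ N ∧ ∀ a ∈ N, ∀ b ∈ N, superBracket a b ∈ N}

variable (F)

/-- The superderivations of `Λ(n)` of parity `p`. -/
def superDer (n : ℕ) (p : ZMod 2) : Submodule F (Module.End F (Grassmann F n)) where
  carrier := {D | (∀ q, ∀ a ∈ part F n q, D a ∈ part F n (p + q)) ∧
    ∀ q, ∀ a ∈ part F n q, ∀ b, D (a * b) = D a * b + (-1 : F) ^ (p * q).val • (a * D b)}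
  zero_mem' := ⟨fun _ _ _ => by simp, fun _ _ _ _ => by simp⟩
  add_mem' := by
    rintro D E ⟨h1, h2⟩ ⟨h3, h4⟩
    refine ⟨fun q a ha => ?_, fun q a ha b => ?_⟩
    · exact Submodule.add_mem _ (h1 q a ha) (h3 q a ha)
    · simp only [LinearMap.add_apply, h2 q a ha b, h4 q a ha b, add_mul, mul_add, smul_add]
      abel
  smul_mem' := by
    rintro c D ⟨h1, h2⟩
    refine ⟨fun q a ha => ?_, fun q a ha b => ?_⟩
    · exact Submodule.smul_mem _ c (h1 q a ha)
    · simp only [LinearMap.smul_apply, h2 q a ha b, smul_add, smul_mul_assoc, mul_smul_comm,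
        smul_comm c]

/-- `W(n) = der Λ(n)`. -/
def W (n : ℕ) : Submodule F (Module.End F (Grassmann F n)) := ⨆ p : ZMod 2, superDer F n p

/-- `W(n)_k`, spanned by the `x^u ∂/∂ξ_i` with `|u| = k + 1`. -/
def Wdeg (n : ℕ) (k : ℤ) : Submodule F (Module.End F (Grassmann F n)) :=
  Submodule.span F {D | ∃ (u : Finset (Fin n)) (i : Fin n),
    (u.card : ℤ) = k + 1 ∧ D = fpd F (mono F u) i}

/-- `D_{ij}(f) = ∂f/∂ξ_i ∂/∂ξ_j + ∂f/∂ξ_j ∂/∂ξ_i`. -/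
def Dij (i j : Fin n) (f : Grassmann F n) : Module.End F (Grassmann F n) :=
  fpd F (pd F i f) j + fpd F (pd F j f) i

/-- `S(n)_k`, spanned by the `D_{ij}(x^u)` with `|u| = k + 2`. -/
def Sdeg (n : ℕ) (k : ℤ) : Submodule F (Module.End F (Grassmann F n)) :=
  Submodule.span F {D | ∃ (u : Finset (Fin n)) (i j : Fin n),
    (u.card : ℤ) = k + 2 ∧ D = Dij F i j (mono F u)}

/-- `S(n) = S(n)_{-1} + ⋯ + S(n)_{n-2}`. -/
def S (n : ℕ) : Submodule F (Module.End F (Grassmann F n)) :=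
  ⨆ k ∈ Set.Icc (-1 : ℤ) (n - 2), Sdeg F n k

/-- `S̃(2m)_k`: for `k = -1` spanned by the `(1 + ξ_1 ⋯ ξ_{2m}) ∂/∂ξ_j`, and equal to `S(2m)_k`
for `k ≥ 0`. -/
def Stdeg (m : ℕ) (k : ℤ) : Submodule F (Module.End F (Grassmann F (2 * m))) :=
  if k = -1 then Submodule.span F (Set.range fun j => fpd F (1 + mono F Finset.univ) j)
  else Sdeg F (2 * m) k

/-- `S̃(2m) = S̃(2m)_{-1} + ⋯ + S̃(2m)_{2m-2}`. -/
def St (m : ℕ) : Submodule F (Module.End F (Grassmann F (2 * m))) :=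
  ⨆ k ∈ Set.Icc (-1 : ℤ) (2 * m - 2), Stdeg F m k

/-- The involution `i ↦ i'` of the indices: with `m = ⌊n/2⌋` it exchanges the `i`-th and the
`(i+m)`-th index for the first `m` indices `i`, and it fixes the last index if `n` is odd. -/
def prime (i : Fin n) : Fin n :=
  if h : i.val < n / 2 then ⟨i.val + n / 2, by omega⟩
  else if i.val < 2 * (n / 2) then ⟨i.val - n / 2, by omega⟩
  else i

/-- `D_H(x^u) = (-1)^{|u|} ∑_i ∂(x^u)/∂ξ_i ∂/∂ξ_{i'}`. -/
def DH (u : Finset (Fin n)) : Module.End F (Grassmann F n) :=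
  (-1 : F) ^ u.card • ∑ i, fpd F (pd F i (mono F u)) (prime i)

/-- `H(n)_k`, spanned by the `D_H(x^u)` with `|u| = k + 2`. -/
def Hdeg (n : ℕ) (k : ℤ) : Submodule F (Module.End F (Grassmann F n)) :=
  Submodule.span F {D | ∃ u : Finset (Fin n), (u.card : ℤ) = k + 2 ∧ D = DH F u}

/-- `H(n) = H(n)_{-1} + ⋯ + H(n)_{n-3}`. -/
def H (n : ℕ) : Submodule F (Module.End F (Grassmann F n)) :=
  ⨆ k ∈ Set.Icc (-1 : ℤ) (n - 3), Hdeg F n k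

/-- The standard Cartan subalgebra of `W(n)_0 ≅ gl(n)`. -/
def cartanW (n : ℕ) : Submodule F (Module.End F (Grassmann F n)) :=
  Submodule.span F (Set.range fun i : Fin n => fpd F (xi F i) i)

/-- The standard Cartan subalgebra of `S(n)_0 ≅ sl(n)`, also used for `S̃(2m)` with `n = 2m`. -/
def cartanS (n : ℕ) : Submodule F (Module.End F (Grassmann F n)) :=
  Submodule.span F {D | ∃ i j : Fin n, D = fpd F (xi F i) i - fpd F (xi F j) j}

/-- The standard Cartan subalgebra of `H(n)_0 ≅ so(n)`. -/
def cartanH (n : ℕ) : Submodule F (Module.End F (Grassmann F n)) :=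
  Submodule.span F {D | ∃ i : Fin n, i.val < n / 2 ∧
    D = fpd F (xi F i) i - fpd F (xi F (prime i)) (prime i)}

variable {F}

/-- `v` is a (nonzero) weight vector of weight `α` in `V` relative to `𝔥`. -/
def IsWeightVector (𝔥 V : Submodule F (Module.End F (Grassmann F n))) (α : Module.Dual F 𝔥)
    (v : Module.End F (Grassmann F n)) : Prop :=
  v ∈ V ∧ v ≠ 0 ∧ ∀ h : 𝔥, superBracket (h : Module.End F (Grassmann F n)) v = α h • v

/-- `Ω_Φ`: the vectors on which the elements of the finite set `Φ` of linear functions take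
pairwise distinct values. -/
def Omega {V : Type*} [AddCommMonoid V] [Module F V] (Φ : Finset (Module.Dual F V)) : Set V :=
  {v | ∀ f ∈ Φ, ∀ g ∈ Φ, f ≠ g → f v ≠ g v}

/-- There are weight vectors `x₋₁ ∈ L₋₁` and `y_1, …, y_r ∈ L_t` of pairwise distinct weights
and an element `x₀ ∈ L₀` such that, for generic `h ∈ 𝔥`, the elements `x₀` and `h` generate `L₀`
and the two elements `x = x₋₁ + x₀ + y_1 + ⋯ + y_r` and `h` generate `L`. -/
def HasCartanGenerators (r : ℕ) (L Lneg L₀ Lt 𝔥 : Submodule F (Module.End F (Grassmann F n))) :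
    Prop :=
  ∃ (α : Module.Dual F 𝔥) (β : Fin r → Module.Dual F 𝔥)
    (xneg x₀ : Module.End F (Grassmann F n)) (y : Fin r → Module.End F (Grassmann F n)),
    IsWeightVector 𝔥 Lneg α xneg ∧ x₀ ∈ L₀ ∧ (∀ i, IsWeightVector 𝔥 Lt (β i) (y i)) ∧
    (∀ i, β i ≠ α) ∧ Function.Injective β ∧
    ∃ Φ : Finset (Module.Dual F 𝔥), (Omega Φ).Nonempty ∧
      ∀ h : 𝔥, h ∈ Omega Φ →
        generated {x₀, (h : Module.End F (Grassmann F n))} = L₀ ∧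
        generated {xneg + x₀ + ∑ i, y i, (h : Module.End F (Grassmann F n))} = L

end CartanSuper

end

/-! The vector `x₀` is taken as a sum of weight vectors `e k` of nonzero, pairwise distinct weights,
none equal to a weight of `x₋₁` or of some `y_i`. Let Φ contain all these weights. For `h` in `Omega
Φ` the eigenvalues of ad h on the summands are distinct, so by Lagrange interpolation a subspace
stable under ad h that contains the sum contains every summand (`mem_of_sum_eigenvectors_mem`). All
summands are homogeneous, so it does not matter that subspaces need not be graded. `Omega Φ` is
nonempty because a vector space over an infinite field is not a finite union of proper subspaces.
Distinctness of the weights is checked at one integral point of the Cartan subalgebra. All this is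
`hasCartanGenerators_of`; it leaves two generation problems, L₀ from the `e k` and `h`, and L from
L₀, `x₋₁` and the `y_i`.

For W, S and S̃ the `e k` are the matrix units of one row and one column, which generate sl(n); for
W the generic `h` supplies the trace. Write T = ξ_1⋯ξ_n. In W and S the algebra L₀ spreads `x₋₁` to
all ∂_j and `y` to the whole top component, and bracketing with the ∂_j then removes variables one
at a time. In S̃ one has [(1+T)∂_i, (1+T)∂_j] = D_ij(T), so the top component already comes from
L₋₁.

For H everything is transported by `ham` to the Poisson bracket on Λ(n), where H(n) is the image of
the span of all monomials except T (`bracket_ham_ham`, `H_eq_map`). The quadrics form so(n). They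
are generated by the ξ_kξ_z with z the fixed index when n is odd, and by the ξ_eξ_j with e in {z,
z'} and j outside it when n is even. One cubic monomial generates all cubics over so(n)
(`homog_three_le_of_odd`, `homog_three_le_of_even`), and brackets with cubics raise the degree up to
n - 1 (`homog_succ_le`). -/

noncomputable section

namespace CartanSuper

/-! ### Superderivation calculus on the Grassmann algebra. -/

section Calculus

variable {F : Type*} [Field F] {n : ℕ}

theorem parity_mul (a b : Grassmann F n) : parity F n (a * b) = parity F n a * parity F n b :=
  map_mul (CliffordAlgebra.involute (Q := (0 : QuadraticForm F (Fin n → F)))) a b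

@[simp] theorem parity_one : parity F n 1 = 1 :=
  map_one (CliffordAlgebra.involute (Q := (0 : QuadraticForm F (Fin n → F))))

@[simp] theorem parity_parity (a : Grassmann F n) : parity F n (parity F n a) = a :=
  CliffordAlgebra.involute_involute a

@[simp] theorem parity_xi (i : Fin n) : parity F n (xi F i) = -xi F i :=
  CliffordAlgebra.involute_ι _

theorem xi_mul_self (i : Fin n) : xi F i * xi F i = 0 := ExteriorAlgebra.ι_sq_zero _

theorem xi_mul_xi (i j : Fin n) : xi F i * xi F j = -(xi F j * xi F i) :=
  eq_neg_of_add_eq_zero_left (ExteriorAlgebra.ι_add_mul_swap _ _)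

theorem ι_eq_sum_xi (v : Fin n → F) : ExteriorAlgebra.ι F v = ∑ i, v i • xi F i := by
  conv_lhs => rw [pi_eq_sum_univ v]
  simp only [map_sum, map_smul, xi]
  refine Finset.sum_congr rfl fun i _ => ?_
  congr 2
  ext j
  simp [Pi.single_apply, eq_comm]

/-- Induction on `Λ(n)` by left multiplication with the generators. -/
theorem grassmann_induction {P : Grassmann F n → Prop} (one : P 1)
    (add : ∀ a b, P a → P b → P (a + b)) (smul : ∀ (c : F) a, P a → P (c • a))
    (mul : ∀ i a, P a → P (xi F i * a)) (a : Grassmann F n) : P a := by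
  refine CliffordAlgebra.left_induction (0 : QuadraticForm F (Fin n → F)) (P := P) ?_ add ?_ a
  · intro r
    rw [Algebra.algebraMap_eq_smul_one]
    exact smul r 1 one
  · intro x v hx
    have h : ∀ s : Finset (Fin n), P (∑ i ∈ s, v i • (xi F i * x)) := by
      intro s
      induction s using Finset.induction_on with
      | empty => simpa using smul 0 1 one
      | insert i s hi ih =>
        rw [Finset.sum_insert hi]
        exact add _ _ (smul _ _ (mul _ _ hx)) ih
    have h2 : ExteriorAlgebra.ι F v * x = ∑ i, v i • (xi F i * x) := by
      rw [ι_eq_sum_xi, Finset.sum_mul]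
      simp
    exact h2 ▸ h Finset.univ

@[simp] theorem pd_one (i : Fin n) : pd F i 1 = 0 :=
  CliffordAlgebra.contractLeft_one (Q := (0 : QuadraticForm F (Fin n → F))) _

theorem pd_xi_mul (i j : Fin n) (b : Grassmann F n) :
    pd F i (xi F j * b) = (if i = j then b else 0) - xi F j * pd F i b := by
  refine (CliffordAlgebra.contractLeft_ι_mul (Q := (0 : QuadraticForm F (Fin n → F)))
    (LinearMap.proj i) (Pi.single j 1) b).trans ?_
  congr 1
  by_cases h : i = j <;> simp [h]

@[simp] theorem pd_xi (i j : Fin n) : pd F i (xi F j) = if i = j then 1 else 0 := by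
  simpa using pd_xi_mul (F := F) i j 1

theorem pd_pd (i j : Fin n) (a : Grassmann F n) : pd F i (pd F j a) = -pd F j (pd F i a) :=
  CliffordAlgebra.contractLeft_comm _ _ _

theorem pd_mul (i : Fin n) (a b : Grassmann F n) :
    pd F i (a * b) = pd F i a * b + parity F n a * pd F i b := by
  induction a using grassmann_induction with
  | one => simp
  | add a c ha hc => simp only [add_mul, map_add, ha, hc]; abel
  | smul c a ha => simp only [smul_mul_assoc, map_smul, ha, smul_add]
  | mul j a ha =>
    rw [mul_assoc, pd_xi_mul, ha, pd_xi_mul, parity_mul, parity_xi]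
    split_ifs <;> noncomm_ring

theorem pd_parity (i : Fin n) (a : Grassmann F n) :
    pd F i (parity F n a) = -parity F n (pd F i a) := by
  induction a using grassmann_induction with
  | one => simp
  | add a c ha hc => simp only [map_add, ha, hc]; abel
  | smul c a ha => simp only [map_smul, ha, smul_neg]
  | mul j a ha =>
    rw [parity_mul, parity_xi, neg_mul, map_neg, pd_xi_mul, ha, pd_xi_mul, map_sub, parity_mul,
      parity_xi]
    split_ifs <;> simp

theorem mul_xi (a : Grassmann F n) (i : Fin n) : a * xi F i = xi F i * parity F n a := by
  induction a using grassmann_induction with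
  | one => simp
  | add a c ha hc => simp only [add_mul, map_add, ha, hc, mul_add]
  | smul c a ha => simp only [smul_mul_assoc, map_smul, ha, mul_smul_comm]
  | mul j a ha =>
    rw [mul_assoc, ha, parity_mul, parity_xi, ← mul_assoc, ← mul_assoc, xi_mul_xi j i]
    simp

theorem mul_eq_mul_of_even {a : Grassmann F n} (ha : parity F n a = a) (b : Grassmann F n) :
    a * b = b * a := by
  induction b using grassmann_induction with
  | one => simp
  | add b c hb hc => simp only [add_mul, mul_add, hb, hc]
  | smul c b hb => simp only [smul_mul_assoc, mul_smul_comm, hb]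
  | mul j b hb => rw [← mul_assoc, mul_xi, ha, mul_assoc, hb, mul_assoc]

theorem mul_eq_mul_of_odd {a : Grassmann F n} (ha : parity F n a = -a) (b : Grassmann F n) :
    a * b = parity F n b * a := by
  induction b using grassmann_induction with
  | one => simp
  | add b c hb hc => simp only [add_mul, mul_add, hb, hc, map_add]
  | smul c b hb => simp only [smul_mul_assoc, mul_smul_comm, hb, map_smul]
  | mul j b hb =>
    rw [← mul_assoc, mul_xi, ha, mul_assoc, neg_mul, hb, parity_mul, parity_xi]
    noncomm_ring

theorem fpd_apply (f : Grassmann F n) (i : Fin n) (a : Grassmann F n) :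
    fpd F f i a = f * pd F i a := rfl

/-- `fpd` as a linear map in the coefficient. -/
def fpdL (i : Fin n) : Grassmann F n →ₗ[F] Module.End F (Grassmann F n) where
  toFun f := fpd F f i
  map_add' f g := LinearMap.ext fun a => by simp [fpd_apply, add_mul]
  map_smul' c f := LinearMap.ext fun a => by simp [fpd_apply]

theorem fpd_add (f g : Grassmann F n) (i : Fin n) : fpd F (f + g) i = fpd F f i + fpd F g i :=
  map_add (fpdL i) f g

theorem fpd_sub (f g : Grassmann F n) (i : Fin n) : fpd F (f - g) i = fpd F f i - fpd F g i :=
  map_sub (fpdL i) f g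

theorem fpd_neg (f : Grassmann F n) (i : Fin n) : fpd F (-f) i = -fpd F f i :=
  map_neg (fpdL i) f

theorem fpd_smul (c : F) (f : Grassmann F n) (i : Fin n) : fpd F (c • f) i = c • fpd F f i :=
  map_smul (fpdL i) c f

@[simp] theorem fpd_zero (i : Fin n) : fpd F 0 i = 0 := map_zero (fpdL (F := F) i)

theorem fpd_sum {ι : Type*} (s : Finset ι) (f : ι → Grassmann F n) (i : Fin n) :
    fpd F (∑ k ∈ s, f k) i = ∑ k ∈ s, fpd F (f k) i :=
  map_sum (fpdL i) f s

theorem fpd_ne_zero {f : Grassmann F n} (hf : f ≠ 0) (i : Fin n) : fpd F f i ≠ 0 := fun h =>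
  hf (by simpa [fpd_apply] using LinearMap.congr_fun h (xi F i))

/-- `component` as a linear map. -/
def componentL (p : ZMod 2) :
    Module.End F (Grassmann F n) →ₗ[F] Module.End F (Grassmann F n) where
  toFun A := component p A
  map_add' A B := by simp only [component, mul_add, add_mul, smul_add]; abel
  map_smul' c A := by
    simp only [component, mul_smul_comm, smul_mul_assoc, smul_add, RingHom.id_apply]
    rw [smul_comm c, smul_comm c (2⁻¹ : F), smul_comm c]

theorem componentL_apply (p : ZMod 2) (A : Module.End F (Grassmann F n)) :
    componentL p A = component p A := rfl

/-- The superbracket as a bilinear map. -/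
def bracketL : Module.End F (Grassmann F n) →ₗ[F] Module.End F (Grassmann F n) →ₗ[F]
    Module.End F (Grassmann F n) :=
  LinearMap.mk₂ F superBracket
    (fun A B C => by
      simp only [superBracket, ← componentL_apply, map_add, add_mul, mul_add, smul_add,
        ← Finset.sum_add_distrib]
      exact Finset.sum_congr rfl fun p _ => Finset.sum_congr rfl fun q _ => by abel)
    (fun c A B => by
      simp only [superBracket, ← componentL_apply, map_smul, smul_mul_assoc, mul_smul_comm,
        Finset.smul_sum, smul_sub]
      exact Finset.sum_congr rfl fun p _ => Finset.sum_congr rfl fun q _ => by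
        rw [smul_comm c])
    (fun A B C => by
      simp only [superBracket, ← componentL_apply, map_add, add_mul, mul_add, smul_add,
        ← Finset.sum_add_distrib]
      exact Finset.sum_congr rfl fun p _ => Finset.sum_congr rfl fun q _ => by abel)
    (fun c A B => by
      simp only [superBracket, ← componentL_apply, map_smul, smul_mul_assoc, mul_smul_comm,
        Finset.smul_sum, smul_sub]
      exact Finset.sum_congr rfl fun p _ => Finset.sum_congr rfl fun q _ => by
        rw [smul_comm c])

theorem bracketL_apply (A B : Module.End F (Grassmann F n)) :
    bracketL A B = superBracket A B := rfl

theorem add_bracket (A B C : Module.End F (Grassmann F n)) :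
    superBracket (A + B) C = superBracket A C + superBracket B C := by
  simp only [← bracketL_apply, map_add, LinearMap.add_apply]

theorem bracket_add (A B C : Module.End F (Grassmann F n)) :
    superBracket A (B + C) = superBracket A B + superBracket A C := by
  simp only [← bracketL_apply, map_add]

theorem smul_bracket (c : F) (A B : Module.End F (Grassmann F n)) :
    superBracket (c • A) B = c • superBracket A B := by
  simp only [← bracketL_apply, map_smul, LinearMap.smul_apply]

theorem bracket_smul (c : F) (A B : Module.End F (Grassmann F n)) :
    superBracket A (c • B) = c • superBracket A B := by
  simp only [← bracketL_apply, map_smul]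

theorem sum_bracket {ι : Type*} (s : Finset ι) (A : ι → Module.End F (Grassmann F n))
    (B : Module.End F (Grassmann F n)) :
    superBracket (∑ k ∈ s, A k) B = ∑ k ∈ s, superBracket (A k) B := by
  simp only [← bracketL_apply, map_sum, LinearMap.sum_apply]

theorem bracket_sum {ι : Type*} (s : Finset ι) (A : Module.End F (Grassmann F n))
    (B : ι → Module.End F (Grassmann F n)) :
    superBracket A (∑ k ∈ s, B k) = ∑ k ∈ s, superBracket A (B k) := by
  simp only [← bracketL_apply, map_sum]

/-- Since ∂_i is odd, conjugating f∂_i by the parity automorphism gives the negative of (parity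
f)∂_i. So the part of f∂_i of parity p comes from the part of f of the opposite parity. -/
theorem component_fpd [CharZero F] (p : ZMod 2) (f : Grassmann F n) (i : Fin n) :
    component p (fpd F f i) = fpd F ((2⁻¹ : F) • (f - (-1 : F) ^ p.val • parity F n f)) i := by
  refine LinearMap.ext fun x => ?_
  simp only [component, fpd_apply, LinearMap.smul_apply, LinearMap.add_apply, Module.End.mul_apply,
    pd_parity, parity_mul, map_neg, parity_parity, smul_mul_assoc, sub_mul, mul_neg, smul_neg]
  rw [sub_eq_add_neg]

theorem zmod_two_sum {M : Type*} [AddCommMonoid M] (f : ZMod 2 → M) :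
    ∑ p : ZMod 2, f p = f 0 + f 1 := Fin.sum_univ_two f

/-- The bracket of two vector fields. -/
theorem bracket_fpd_fpd [CharZero F] (f g : Grassmann F n) (i j : Fin n) :
    superBracket (fpd F f i) (fpd F g j) =
      fpd F (f * pd F i g) j + fpd F (pd F j (parity F n f) * g) i := by
  -- Both sides are bilinear in f and g, so it is enough to treat even and odd coefficients, in four
  -- cases.
  have hdec : ∀ a : Grassmann F n, ∃ a0 a1, a = a0 + a1 ∧ parity F n a0 = a0 ∧
      parity F n a1 = -a1 := fun a => by
    refine ⟨(2⁻¹ : F) • (a + parity F n a), (2⁻¹ : F) • (a - parity F n a), ?_, ?_, ?_⟩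
    · rw [← smul_add, add_add_sub_cancel, ← two_smul F a, smul_smul]
      simp
    · simp [add_comm]
    · simp [← smul_neg]
  have half : ∀ a : Grassmann F n, (2⁻¹ : F) • (a + a) = a := fun a => by
    rw [← two_smul F a, smul_smul]; simp
  have c0 : ∀ (a : Grassmann F n) (k : Fin n), parity F n a = a →
      component 0 (fpd F a k) = 0 ∧ component 1 (fpd F a k) = fpd F a k := fun a k ha => by
    have h1 : (1 : ZMod 2).val = 1 := rfl
    constructor <;> simp [component_fpd, ha, h1, half]
  have c1 : ∀ (a : Grassmann F n) (k : Fin n), parity F n a = -a →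
      component 1 (fpd F a k) = 0 ∧ component 0 (fpd F a k) = fpd F a k := fun a k ha => by
    have h1 : (1 : ZMod 2).val = 1 := rfl
    constructor <;> simp [component_fpd, ha, h1, half]
  have h1 : (1 : ZMod 2).val = 1 := rfl
  -- The ∂'s anticommute, so the second-order parts of the two products cancel and a first-order
  -- operator remains.
  have key : ∀ x, pd F j (pd F i x) = -pd F i (pd F j x) := pd_pd j i
  have oddpd : ∀ (a : Grassmann F n) (k : Fin n), parity F n a = -a →
      parity F n (pd F k a) = pd F k a := fun a k ha => by
    rw [← neg_inj, ← pd_parity, ha, map_neg]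
  have evenpd : ∀ (a : Grassmann F n) (k : Fin n), parity F n a = a →
      parity F n (pd F k a) = -pd F k a := fun a k ha => by
    rw [← neg_inj, ← pd_parity, ha, neg_neg]
  obtain ⟨f0, f1, rfl, hf0, hf1⟩ := hdec f
  obtain ⟨g0, g1, rfl, hg0, hg1⟩ := hdec g
  have h00 : superBracket (fpd F f0 i) (fpd F g0 j) =
      fpd F (f0 * pd F i g0) j + fpd F (pd F j (parity F n f0) * g0) i := by
    refine LinearMap.ext fun x => ?_
    simp only [superBracket, zmod_two_sum, c0 f0 i hf0, c0 g0 j hg0, hf0]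
    simp [fpd_apply, h1, pd_mul, hf0, hg0, key]
    simp only [mul_add, mul_neg, ← mul_assoc, mul_eq_mul_of_even hg0 (pd F j f0),
      mul_eq_mul_of_even hg0 f0]
    noncomm_ring
  have h01 : superBracket (fpd F f0 i) (fpd F g1 j) =
      fpd F (f0 * pd F i g1) j + fpd F (pd F j (parity F n f0) * g1) i := by
    refine LinearMap.ext fun x => ?_
    simp only [superBracket, zmod_two_sum, c0 f0 i hf0, c1 g1 j hg1, hf0]
    simp [fpd_apply, h1, pd_mul, hf0, hg1, key]
    simp only [mul_add, mul_neg, ← mul_assoc, mul_eq_mul_of_odd hg1 (pd F j f0),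
      mul_eq_mul_of_odd hg1 f0, evenpd f0 j hf0, hf0]
    noncomm_ring
  have h10 : superBracket (fpd F f1 i) (fpd F g0 j) =
      fpd F (f1 * pd F i g0) j + fpd F (pd F j (parity F n f1) * g0) i := by
    refine LinearMap.ext fun x => ?_
    simp only [superBracket, zmod_two_sum, c1 f1 i hf1, c0 g0 j hg0, hf1]
    simp [fpd_apply, h1, pd_mul, hf1, hg0, key]
    simp only [mul_add, ← mul_assoc, mul_eq_mul_of_even hg0 (pd F j f1),
      mul_eq_mul_of_even hg0 f1]
    noncomm_ring
  have h11 : superBracket (fpd F f1 i) (fpd F g1 j) =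
      fpd F (f1 * pd F i g1) j + fpd F (pd F j (parity F n f1) * g1) i := by
    refine LinearMap.ext fun x => ?_
    simp only [superBracket, zmod_two_sum, c1 f1 i hf1, c1 g1 j hg1, hf1]
    simp [fpd_apply, h1, pd_mul, hf1, hg1, key]
    simp only [mul_add, mul_neg, ← mul_assoc, mul_eq_mul_of_odd hg1 (pd F j f1),
      mul_eq_mul_of_odd hg1 f1, oddpd f1 j hf1, hf1]
    noncomm_ring
  simp only [fpd_add, add_bracket, bracket_add, map_add, add_mul, mul_add, h00, h01, h10, h11]
  abel

end Calculus

/-! ### Monomials, degrees and diagonal vector fields. -/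

section Monomials

variable {F : Type*} [Field F] {n : ℕ}

variable (F) in
/-- The product `ξ_{i_1} ⋯ ξ_{i_k}` along a list of indices. -/
def prodXi (l : List (Fin n)) : Grassmann F n := (l.map (xi F)).prod

theorem prodXi_cons (i : Fin n) (l : List (Fin n)) : prodXi F (i :: l) = xi F i * prodXi F l := by
  simp [prodXi]

theorem prodXi_append (l l' : List (Fin n)) :
    prodXi F (l ++ l') = prodXi F l * prodXi F l' := by
  simp [prodXi]

theorem mono_eq_prodXi (u : Finset (Fin n)) : mono F u = prodXi F (u.sort (· ≤ ·)) := rfl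

/-- The sign of the permutation is deliberately left undetermined: only membership in subspaces is
ever tested, and there signs are irrelevant. -/
theorem prodXi_perm {l l' : List (Fin n)} (h : l.Perm l') :
    prodXi F l = prodXi F l' ∨ prodXi F l = -prodXi F l' := by
  induction h with
  | nil => exact Or.inl rfl
  | cons i _ ih =>
    rw [prodXi_cons, prodXi_cons]
    rcases ih with h | h <;> rw [h]
    · exact Or.inl rfl
    · exact Or.inr (mul_neg _ _)
  | swap i j l =>
    right
    simp only [prodXi_cons, ← mul_assoc]
    rw [xi_mul_xi j i, neg_mul]
  | trans _ _ h1 h2 =>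
    rcases h1 with h1 | h1 <;> rcases h2 with h2 | h2 <;> simp [h1, h2]

theorem xi_mul_prodXi_of_mem {i : Fin n} {l : List (Fin n)} (h : i ∈ l) :
    xi F i * prodXi F l = 0 := by
  induction l with
  | nil => simp at h
  | cons j l ih =>
    rw [prodXi_cons]
    rcases List.mem_cons.1 h with rfl | h
    · rw [← mul_assoc, xi_mul_self, zero_mul]
    · rw [← mul_assoc, xi_mul_xi, neg_mul, mul_assoc, ih h, mul_zero, neg_zero]

theorem prodXi_eq_zero {l : List (Fin n)} (h : ¬l.Nodup) : prodXi F l = 0 := by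
  induction l with
  | nil => simp at h
  | cons i l ih =>
    rw [prodXi_cons]
    by_cases hi : i ∈ l
    · exact xi_mul_prodXi_of_mem hi
    · rw [ih (fun hl => h (List.nodup_cons.2 ⟨hi, hl⟩)), mul_zero]

theorem prodXi_eq_mono {l : List (Fin n)} (h : l.Nodup) :
    prodXi F l = mono F l.toFinset ∨ prodXi F l = -mono F l.toFinset := by
  rw [mono_eq_prodXi]
  refine prodXi_perm ?_
  rw [List.perm_ext_iff_of_nodup h (Finset.sort_nodup _ _)]
  simp

@[simp] theorem mono_empty : mono F (∅ : Finset (Fin n)) = 1 := by simp [mono]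

@[simp] theorem mono_singleton (i : Fin n) : mono F {i} = xi F i := by simp [mono]

theorem xi_mul_mono_of_notMem {i : Fin n} {u : Finset (Fin n)} (h : i ∉ u) :
    xi F i * mono F u = mono F (insert i u) ∨ xi F i * mono F u = -mono F (insert i u) := by
  have := prodXi_eq_mono (F := F) (l := i :: u.sort (· ≤ ·))
    (List.nodup_cons.2 ⟨by simpa using h, Finset.sort_nodup _ _⟩)
  simpa [prodXi_cons, mono_eq_prodXi] using this

theorem xi_mul_mono_of_mem {i : Fin n} {u : Finset (Fin n)} (h : i ∈ u) :
    xi F i * mono F u = 0 :=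
  xi_mul_prodXi_of_mem (by simpa using h)

theorem mono_eq_xi_mul {i : Fin n} {u : Finset (Fin n)} (h : i ∈ u) :
    mono F u = xi F i * mono F (u.erase i) ∨ mono F u = -(xi F i * mono F (u.erase i)) := by
  have := xi_mul_mono_of_notMem (F := F) (Finset.notMem_erase i u)
  rw [Finset.insert_erase h] at this
  rcases this with h | h <;> simp [h]

theorem pd_prodXi_of_notMem {i : Fin n} {l : List (Fin n)} (h : i ∉ l) :
    pd F i (prodXi F l) = 0 := by
  induction l with
  | nil => simp [prodXi]
  | cons j l ih =>
    simp only [List.mem_cons, not_or] at h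
    rw [prodXi_cons, pd_xi_mul, if_neg h.1, ih h.2]
    simp

theorem pd_mono_of_notMem {i : Fin n} {u : Finset (Fin n)} (h : i ∉ u) :
    pd F i (mono F u) = 0 :=
  pd_prodXi_of_notMem (by simpa using h)

theorem pd_mono_of_mem {i : Fin n} {u : Finset (Fin n)} (h : i ∈ u) :
    pd F i (mono F u) = mono F (u.erase i) ∨ pd F i (mono F u) = -mono F (u.erase i) := by
  have h0 := pd_mono_of_notMem (F := F) (Finset.notMem_erase i u)
  rcases mono_eq_xi_mul (F := F) h with h | h <;> rw [h]
  · left; simp [pd_xi_mul, h0]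
  · right; simp [pd_xi_mul, h0]

/-- ξ_i∂_i counts the occurrences of ξ_i, so monomials are eigenvectors of all diagonal fields. -/
theorem xi_mul_pd_mono (i : Fin n) (u : Finset (Fin n)) :
    xi F i * pd F i (mono F u) = if i ∈ u then mono F u else 0 := by
  split_ifs with h
  · have h0 := pd_mono_of_notMem (F := F) (Finset.notMem_erase i u)
    rcases mono_eq_xi_mul (F := F) h with h | h <;> rw [h] <;> simp [pd_xi_mul, h0]
  · rw [pd_mono_of_notMem h, mul_zero]

theorem xi_mul_pd_mono_of_mem {i j : Fin n} (hij : i ≠ j) {u : Finset (Fin n)} (h : i ∈ u) :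
    xi F i * pd F j (mono F u) = 0 := by
  by_cases hj : j ∈ u
  · rcases pd_mono_of_mem (F := F) hj with h' | h' <;>
      simp [h', xi_mul_mono_of_mem (F := F) (Finset.mem_erase.2 ⟨hij, h⟩)]
  · rw [pd_mono_of_notMem hj, mul_zero]

theorem mono_ne_zero (u : Finset (Fin n)) : mono F u ≠ 0 := by
  induction u using Finset.induction_on with
  | empty => simp
  | insert i u hi ih =>
    intro h
    rcases pd_mono_of_mem (F := F) (Finset.mem_insert_self i u) with h' | h' <;>
      rw [h, map_zero, Finset.erase_insert hi] at h'
    · exact ih h'.symm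
    · exact ih (neg_eq_zero.1 h'.symm)

theorem mono_mem_of_prodXi_mem {V : Submodule F (Grassmann F n)} {l : List (Fin n)}
    {u : Finset (Fin n)} (hl : l.Nodup) (hu : l.toFinset = u) (h : prodXi F l ∈ V) :
    mono F u ∈ V := by
  subst hu
  rcases prodXi_eq_mono (F := F) hl with h' | h' <;> rw [h'] at h
  · exact h
  · exact V.neg_mem_iff.1 h

theorem prodXi_mem_of_mono_mem {V : Submodule F (Grassmann F n)} {l : List (Fin n)}
    (h : l.Nodup → mono F l.toFinset ∈ V) : prodXi F l ∈ V := by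
  by_cases hl : l.Nodup
  · rcases prodXi_eq_mono (F := F) hl with h' | h' <;> rw [h']
    · exact h hl
    · exact V.neg_mem (h hl)
  · rw [prodXi_eq_zero hl]
    exact V.zero_mem

theorem span_mono : Submodule.span F (Set.range (mono F (n := n))) = ⊤ := by
  rw [Submodule.eq_top_iff']
  have key : ∀ i, ∀ a ∈ Submodule.span F (Set.range (mono F (n := n))),
      xi F i * a ∈ Submodule.span F (Set.range (mono F (n := n))) := by
    intro i a ha
    induction ha using Submodule.span_induction with
    | mem x hx =>
      obtain ⟨u, rfl⟩ := hx
      by_cases h : i ∈ u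
      · rw [xi_mul_mono_of_mem h]; exact zero_mem _
      · have hm : mono F (insert i u) ∈ Submodule.span F (Set.range (mono F (n := n))) :=
          Submodule.subset_span ⟨_, rfl⟩
        rcases xi_mul_mono_of_notMem (F := F) h with h' | h' <;> rw [h']
        · exact hm
        · exact neg_mem hm
    | zero => simp
    | add x y _ _ hx hy => rw [mul_add]; exact add_mem hx hy
    | smul c x _ hx => rw [mul_smul_comm]; exact Submodule.smul_mem _ _ hx
  intro a
  induction a using grassmann_induction with
  | one => exact Submodule.subset_span ⟨∅, by simp⟩
  | add a b ha hb => exact add_mem ha hb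
  | smul c a ha => exact Submodule.smul_mem _ _ ha
  | mul i a ha => exact key i a ha

variable (F) in
/-- The homogeneous component of degree `k` of `Λ(n)`. -/
def homog (n k : ℕ) : Submodule F (Grassmann F n) :=
  Submodule.span F {a | ∃ u : Finset (Fin n), u.card = k ∧ a = mono F u}

theorem mono_mem_homog {u : Finset (Fin n)} {k : ℕ} (h : u.card = k) : mono F u ∈ homog F n k :=
  Submodule.subset_span ⟨u, h, rfl⟩

theorem homog_le {k : ℕ} {V : Submodule F (Grassmann F n)}
    (h : ∀ u : Finset (Fin n), u.card = k → mono F u ∈ V) : homog F n k ≤ V :=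
  Submodule.span_le.2 (by rintro _ ⟨u, hu, rfl⟩; exact h u hu)

theorem xi_mem_homog (i : Fin n) : xi F i ∈ homog F n 1 := by
  simpa using mono_mem_homog (F := F) (Finset.card_singleton i)

theorem prodXi_mem_homog (l : List (Fin n)) : prodXi F l ∈ homog F n l.length :=
  prodXi_mem_of_mono_mem fun h => mono_mem_homog (List.toFinset_card_of_nodup h)

theorem homog_eq_bot {k : ℕ} (h : n < k) : homog F n k = ⊥ := by
  rw [eq_bot_iff]
  refine homog_le fun u hu => ?_
  have := u.card_le_univ
  simp at this
  omega

theorem mul_mem_homog {k l : ℕ} {a b : Grassmann F n} (ha : a ∈ homog F n k)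
    (hb : b ∈ homog F n l) : a * b ∈ homog F n (k + l) := by
  have h1 : homog F n k ≤ (homog F n (k + l)).comap (LinearMap.mulRight F b) := by
    refine homog_le fun u hu => ?_
    have h2 : homog F n l ≤ (homog F n (k + l)).comap (LinearMap.mulLeft F (mono F u)) := by
      refine homog_le fun v hv => ?_
      have := prodXi_mem_homog (F := F) (u.sort (· ≤ ·) ++ v.sort (· ≤ ·))
      simpa [prodXi_append, hu, hv, ← mono_eq_prodXi] using this
    exact h2 hb
  exact h1 ha

theorem mul_eq_zero_of_mem_homog {k l : ℕ} {a b : Grassmann F n} (ha : a ∈ homog F n k)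
    (hb : b ∈ homog F n l) (h : n < k + l) : a * b = 0 := by
  simpa [homog_eq_bot h] using mul_mem_homog ha hb

theorem pd_mem_homog {k : ℕ} {a : Grassmann F n} (ha : a ∈ homog F n (k + 1)) (i : Fin n) :
    pd F i a ∈ homog F n k := by
  have : homog F n (k + 1) ≤ (homog F n k).comap (pd F i) := by
    refine homog_le fun u hu => ?_
    rw [Submodule.mem_comap]
    by_cases h : i ∈ u
    · have hm : mono F (u.erase i) ∈ homog F n k :=
        mono_mem_homog (by rw [Finset.card_erase_of_mem h, hu]; rfl)
      rcases pd_mono_of_mem (F := F) h with h' | h' <;> rw [h']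
      · exact hm
      · exact neg_mem hm
    · rw [pd_mono_of_notMem h]; exact zero_mem _
  exact this ha

theorem parity_prodXi (l : List (Fin n)) : parity F n (prodXi F l) = (-1 : F) ^ l.length • prodXi F l := by
  induction l with
  | nil => simp [prodXi]
  | cons i l ih =>
    rw [prodXi_cons, parity_mul, ih, parity_xi, List.length_cons, pow_succ]
    simp

theorem parity_mono (u : Finset (Fin n)) : parity F n (mono F u) = (-1 : F) ^ u.card • mono F u := by
  rw [mono_eq_prodXi, parity_prodXi, Finset.length_sort]

theorem parity_of_mem_homog {k : ℕ} {a : Grassmann F n} (ha : a ∈ homog F n k) :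
    parity F n a = (-1 : F) ^ k • a := by
  have : homog F n k ≤ LinearMap.ker (parity F n - (-1 : F) ^ k • LinearMap.id) :=
    homog_le fun u hu => by simp [parity_mono, hu]
  simpa [sub_eq_zero] using this ha

theorem parity_mem_homog {k : ℕ} {a : Grassmann F n} (ha : a ∈ homog F n k) :
    parity F n a ∈ homog F n k := by
  rw [parity_of_mem_homog ha]
  exact Submodule.smul_mem _ _ ha

theorem mem_algebraMap_of_homog_zero {a : Grassmann F n} (ha : a ∈ homog F n 0) :
    ∃ c : F, a = c • 1 := by
  have : homog F n 0 ≤ Submodule.span F {1} := homog_le fun u hu => by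
    rw [Finset.card_eq_zero.1 hu, mono_empty]
    exact Submodule.mem_span_singleton_self _
  obtain ⟨c, hc⟩ := Submodule.mem_span_singleton.1 (this ha)
  exact ⟨c, hc.symm⟩

/-- The diagonal vector field `∑ c_i ξ_i ∂/∂ξ_i`. -/
def diag (c : Fin n → F) : Module.End F (Grassmann F n) := ∑ i, c i • fpd F (xi F i) i

theorem diag_mono (c : Fin n → F) (u : Finset (Fin n)) :
    diag c (mono F u) = (∑ i ∈ u, c i) • mono F u := by
  simp [diag, LinearMap.sum_apply, fpd_apply, xi_mul_pd_mono, Finset.sum_smul,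
    smul_ite]

theorem bracket_diag_fpd [CharZero F] (c : Fin n → F) (g : Grassmann F n) (j : Fin n) :
    superBracket (diag c) (fpd F g j) = fpd F (diag c g) j - c j • fpd F g j := by
  simp only [diag, sum_bracket, smul_bracket, bracket_fpd_fpd, parity_xi, map_neg, pd_xi,
    LinearMap.sum_apply, LinearMap.smul_apply, fpd_apply, fpd_sum, fpd_smul, smul_add,
    Finset.sum_add_distrib, sub_eq_add_neg]
  congr 1
  rw [Finset.sum_eq_single j]
  · simp [fpd_neg]
  · intro i _ hi
    simp [Ne.symm hi]
  · simp

/-- The coordinate `c_i` of a diagonal vector field. -/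
def coord (i : Fin n) : Module.Dual F (Module.End F (Grassmann F n)) :=
  (ExteriorAlgebra.algebraMapInv.toLinearMap ∘ₗ pd F i) ∘ₗ LinearMap.applyₗ (xi F i)

theorem coord_apply (i : Fin n) (A : Module.End F (Grassmann F n)) :
    coord i A = ExteriorAlgebra.algebraMapInv (pd F i (A (xi F i))) := rfl

theorem coord_fpd_xi (i j : Fin n) :
    coord i (fpd F (xi F j) j) = if i = j then 1 else 0 := by
  rw [coord_apply, fpd_apply, pd_xi]
  by_cases h : i = j
  · simp [h]
  · simp [h, Ne.symm h]

theorem coord_diag (c : Fin n → F) (i : Fin n) : coord i (diag c) = c i := by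
  simp [diag, coord_fpd_xi]

theorem fpd_xi_eq_diag (i : Fin n) : fpd F (xi F i) i = diag (Pi.single i 1) := by
  simp [diag, Pi.single_apply, ite_smul]

theorem diag_add (c d : Fin n → F) : diag (c + d) = diag c + diag d := by
  simp [diag, add_smul, Finset.sum_add_distrib]

theorem diag_smul (a : F) (c : Fin n → F) : diag (a • c) = a • diag c := by
  simp [diag, smul_smul, Finset.smul_sum]

theorem diag_coord_of_mem_cartanW {h : Module.End F (Grassmann F n)} (hh : h ∈ cartanW F n) :
    diag (fun i => coord i h) = h := by
  induction hh using Submodule.span_induction with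
  | mem x hx =>
    obtain ⟨i, rfl⟩ := hx
    beta_reduce
    rw [fpd_xi_eq_diag]
    simp only [coord_diag]
  | zero => simp [diag]
  | add x y _ _ hx hy =>
    conv_rhs => rw [← hx, ← hy]
    rw [← diag_add]
    congr 1
    ext i
    simp
  | smul c x _ hx =>
    conv_rhs => rw [← hx]
    rw [← diag_smul]
    congr 1
    ext i
    simp

theorem diag_mem_cartanW (c : Fin n → F) : diag c ∈ cartanW F n :=
  Submodule.sum_mem _ fun i _ => Submodule.smul_mem _ _ (Submodule.subset_span ⟨i, rfl⟩)

end Monomials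

/-! ### Separation of weights and the generation criterion. -/

/-- A submodule invariant under `T` that contains a sum of eigenvectors with distinct eigenvalues
contains each of them. -/
theorem mem_of_sum_eigenvectors_mem {F V ι : Type*} [Field F] [AddCommGroup V] [Module F V]
    [Fintype ι] {T : Module.End F V} {N : Submodule F V} (hN : ∀ v ∈ N, T v ∈ N)
    {v : ι → V} {c : ι → F} (hv : ∀ i, T (v i) = c i • v i) (hc : Function.Injective c)
    (hs : ∑ i, v i ∈ N) (i : ι) : v i ∈ N := by
  classical
  have hp : ∀ p : Polynomial F, ∀ w ∈ N, Polynomial.aeval T p w ∈ N := by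
    intro p w hw
    induction p using Polynomial.induction_on' with
    | add p q hp hq => rw [map_add, LinearMap.add_apply]; exact add_mem hp hq
    | monomial k a =>
      rw [Polynomial.aeval_monomial, Module.algebraMap_end_eq_smul_id, Module.End.mul_apply]
      refine Submodule.smul_mem _ _ ?_
      rw [LinearMap.id_apply]
      induction k with
      | zero => simpa using hw
      | succ k ih => rw [pow_succ', Module.End.mul_apply]; exact hN _ ih
  have he : ∀ (p : Polynomial F) (j : ι), Polynomial.aeval T p (v j) = p.eval (c j) • v j := by
    intro p j
    induction p using Polynomial.induction_on' with
    | add p q hp hq => rw [map_add, LinearMap.add_apply, hp, hq, Polynomial.eval_add, add_smul]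
    | monomial k a =>
      rw [Polynomial.aeval_monomial, Module.algebraMap_end_eq_smul_id, Module.End.mul_apply,
        Polynomial.eval_monomial, mul_smul, LinearMap.smul_apply, LinearMap.id_apply]
      congr 1
      induction k with
      | zero => simp
      | succ k ih => rw [pow_succ', Module.End.mul_apply, ih, map_smul, hv, smul_smul, pow_succ]
  -- The Lagrange polynomial that is 1 at `c i` and 0 at the other eigenvalues, evaluated at `T`,
  -- projects the sum to `v i`.
  have := hp (Lagrange.basis Finset.univ c i) _ hs
  rw [map_sum, Finset.sum_eq_single i] at this
  · rwa [he, Lagrange.eval_basis_self hc.injOn (Finset.mem_univ i), one_smul] at this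
  · intro j _ hj
    rw [he, Lagrange.eval_basis_of_ne hj.symm (Finset.mem_univ j), zero_smul]
  · simp

/-- The complement of `Omega Φ` is the union of the kernels of f - g, which are finitely many proper
subspaces and cannot cover a space over an infinite field. -/
theorem omega_nonempty {F V : Type*} [Field F] [Infinite F] [AddCommGroup V] [Module F V]
    (Φ : Finset (Module.Dual F V)) : (Omega Φ).Nonempty := by
  classical
  let s : Finset (Submodule F V) := Φ.offDiag.image fun p => LinearMap.ker (p.1 - p.2)
  have hs : ⊤ ∉ s := by
    intro h
    obtain ⟨⟨f, g⟩, hp, hfg⟩ := Finset.mem_image.1 h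
    rw [LinearMap.ker_eq_top, sub_eq_zero] at hfg
    exact (Finset.mem_offDiag.1 hp).2.2 hfg
  obtain ⟨v, hv⟩ := (Set.ne_univ_iff_exists_notMem _).1
    (Subspace.biUnion_ne_univ_of_top_notMem hs)
  refine ⟨v, fun f hf g hg hfg h => hv ?_⟩
  simp only [Set.mem_iUnion]
  refine ⟨_, Finset.mem_image.2 ⟨(f, g), Finset.mem_offDiag.2 ⟨hf, hg, hfg⟩, rfl⟩, ?_⟩
  simp [h]

variable {F : Type*} [Field F] {n : ℕ}

/-- A subspace closed under the superbracket. -/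
def BracketClosed (N : Submodule F (Module.End F (Grassmann F n))) : Prop :=
  ∀ a ∈ N, ∀ b ∈ N, superBracket a b ∈ N

theorem bracketClosed_span {s : Set (Module.End F (Grassmann F n))}
    (h : ∀ a ∈ s, ∀ b ∈ s, superBracket a b ∈ Submodule.span F s) :
    BracketClosed (Submodule.span F s) := by
  intro a ha b hb
  induction ha using Submodule.span_induction with
  | mem x hx =>
    induction hb using Submodule.span_induction with
    | mem y hy => exact h x hx y hy
    | zero => rw [← bracketL_apply, map_zero]; exact zero_mem _
    | add y z _ _ hy hz => rw [bracket_add]; exact add_mem hy hz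
    | smul c y _ hy => rw [bracket_smul]; exact Submodule.smul_mem _ _ hy
  | zero => rw [← bracketL_apply, map_zero, LinearMap.zero_apply]; exact zero_mem _
  | add y z _ _ hy hz => rw [add_bracket]; exact add_mem hy hz
  | smul c y _ hy => rw [smul_bracket]; exact Submodule.smul_mem _ _ hy

theorem generated_le {X : Set (Module.End F (Grassmann F n))}
    {N : Submodule F (Module.End F (Grassmann F n))} (hX : X ⊆ N) (hN : BracketClosed N) :
    generated X ≤ N :=
  sInf_le ⟨hX, hN⟩

theorem subset_generated (X : Set (Module.End F (Grassmann F n))) :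
    X ⊆ (generated X : Set (Module.End F (Grassmann F n))) := fun x hx => by
  rw [generated, SetLike.mem_coe, Submodule.mem_sInf]
  exact fun N hN => hN.1 hx

theorem bracketClosed_generated (X : Set (Module.End F (Grassmann F n))) :
    BracketClosed (generated X) := by
  intro a ha b hb
  rw [generated, Submodule.mem_sInf] at *
  exact fun N hN => hN.2 a (ha N hN) b (hb N hN)

/-- Criterion for `HasCartanGenerators`: the element `x₀` is the sum of weight vectors `e k` that
generate `L₀`, and the weights of all the vectors involved take pairwise distinct integral values
at some element `h₀` of the Cartan subalgebra. -/
theorem hasCartanGenerators_of [CharZero F] {r : ℕ}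
    {L Lneg L₀ Lt 𝔥 : Submodule F (Module.End F (Grassmann F n))}
    {κ : Type*} [Fintype κ] (ρ : κ → Module.Dual F 𝔥) (e : κ → Module.End F (Grassmann F n))
    (α : Module.Dual F 𝔥) (xneg : Module.End F (Grassmann F n)) (β : Fin r → Module.Dual F 𝔥)
    (y : Fin r → Module.End F (Grassmann F n)) (Φ₀ : Finset (Module.Dual F 𝔥))
    (hneg : IsWeightVector 𝔥 Lneg α xneg) (hy : ∀ i, IsWeightVector 𝔥 Lt (β i) (y i))
    (he : ∀ k, ∀ h : 𝔥, superBracket (h : Module.End F (Grassmann F n)) (e k) = ρ k h • e k)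
    (heL : ∀ k, e k ∈ L₀) (h₀ : 𝔥) (w : κ → ℤ) (a : ℤ) (b : Fin r → ℤ)
    (hw : ∀ k, ρ k h₀ = w k) (ha : α h₀ = a) (hb : ∀ i, β i h₀ = b i)
    (winj : Function.Injective w) (binj : Function.Injective b) (hab : ∀ i, b i ≠ a)
    (hwa : ∀ k, w k ≠ a) (hwb : ∀ k i, w k ≠ b i)
    (hL₀ : BracketClosed L₀) (hL : BracketClosed L) (h𝔥 : 𝔥 ≤ L₀) (hle : L₀ ≤ L)
    (hnegle : Lneg ≤ L) (htle : Lt ≤ L)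
    (gen₀ : ∀ h : 𝔥, h ∈ Omega Φ₀ → ∀ N, BracketClosed N →
      (h : Module.End F (Grassmann F n)) ∈ N → (∀ k, e k ∈ N) → L₀ ≤ N)
    (gen : ∀ N, BracketClosed N → L₀ ≤ N → xneg ∈ N → (∀ i, y i ∈ N) → L ≤ N) :
    HasCartanGenerators r L Lneg L₀ Lt 𝔥 := by
  classical
  let wt : κ ⊕ Option (Fin r) → Module.Dual F 𝔥 := Sum.elim ρ fun o => o.elim α β
  let v : κ ⊕ Option (Fin r) → Module.End F (Grassmann F n) := Sum.elim e fun o => o.elim xneg y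
  have hv : ∀ (h : 𝔥) z, superBracket (h : Module.End F (Grassmann F n)) (v z) = wt z h • v z := by
    rintro h (k | _ | i)
    · exact he k h
    · exact hneg.2.2 h
    · exact (hy i).2.2 h
  let wz : κ ⊕ Option (Fin r) → ℤ := Sum.elim w fun o => o.elim a b
  have hwz : ∀ z, wt z h₀ = wz z := by
    rintro (k | _ | i)
    · exact hw k
    · exact ha
    · exact hb i
  have hwzinj : Function.Injective wz := by
    rintro (k | _ | i) (k' | _ | i') h
    · rw [winj h]
    · exact absurd h (hwa k)
    · exact absurd h (hwb k i')
    · exact absurd h.symm (hwa k')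
    · rfl
    · exact absurd h.symm (hab i')
    · exact absurd h.symm (hwb k' i)
    · exact absurd h (hab i)
    · rw [binj h]
  -- Linear functions with different values at the single point `h₀` are different; characteristic 0
  -- allows the comparison in ℤ.
  have hwt : Function.Injective wt := fun z z' h => hwzinj (by
    have := hwz z
    rw [h, hwz z'] at this
    exact_mod_cast this.symm)
  have hsep : ∀ h : 𝔥, h ∈ Omega (Φ₀ ∪ Finset.univ.image wt) →
      Function.Injective fun z => wt z h := by
    intro h hh z z' hz
    by_contra hne
    exact hh _ (Finset.mem_union_right _ (Finset.mem_image_of_mem _ (Finset.mem_univ z))) _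
      (Finset.mem_union_right _ (Finset.mem_image_of_mem _ (Finset.mem_univ z')))
      (fun h => hne (hwt h)) hz
  refine ⟨α, β, xneg, ∑ k, e k, y, hneg, Submodule.sum_mem _ fun k _ => heL k, hy, ?_, ?_,
    Φ₀ ∪ Finset.univ.image wt, omega_nonempty (V := 𝔥) _, fun h hh => ⟨?_, ?_⟩⟩
  · intro i h
    have := @hwt (Sum.inr (some i)) (Sum.inr none) h
    simp at this
  · intro i i' h
    have := @hwt (Sum.inr (some i)) (Sum.inr (some i')) h
    simpa using this
  · have hh₀ : h ∈ Omega Φ₀ := fun f hf g hg =>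
      hh f (Finset.mem_union_left _ hf) g (Finset.mem_union_left _ hg)
    refine le_antisymm (generated_le ?_ hL₀)
      (gen₀ h hh₀ _ (bracketClosed_generated _) (subset_generated _ (by simp)) ?_)
    · rintro x (rfl | rfl)
      · exact Submodule.sum_mem _ fun k _ => heL k
      · exact h𝔥 h.2
    · exact mem_of_sum_eigenvectors_mem (T := bracketL (h : Module.End F (Grassmann F n)))
        (fun v hv => bracketClosed_generated _ _ (subset_generated _ (by simp)) _ hv)
        (he · h) (fun k k' hk => by simpa using @hsep h hh (Sum.inl k) (Sum.inl k') hk)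
        (subset_generated _ (by simp))
  · have hh₀ : h ∈ Omega Φ₀ := fun f hf g hg =>
      hh f (Finset.mem_union_left _ hf) g (Finset.mem_union_left _ hg)
    set x := xneg + ∑ k, e k + ∑ i, y i with hx
    have hxv : x = ∑ z, v z := by
      simp [hx, v, Fintype.sum_sum_type, Fintype.sum_option]
      abel
    have hmem : ∀ z, v z ∈ generated {x, (h : Module.End F (Grassmann F n))} :=
      mem_of_sum_eigenvectors_mem (T := bracketL (h : Module.End F (Grassmann F n)))
        (fun v hv => bracketClosed_generated _ _ (subset_generated _ (by simp)) _ hv)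
        (hv h) (hsep h hh) (hxv ▸ subset_generated _ (by simp))
    refine le_antisymm (generated_le ?_ hL) (gen _ (bracketClosed_generated _) ?_
      (hmem (Sum.inr none)) fun i => hmem (Sum.inr (some i)))
    · rintro z (rfl | rfl)
      · exact add_mem (add_mem (hnegle hneg.1) (Submodule.sum_mem _ fun k _ => hle (heL k)))
          (Submodule.sum_mem _ fun i _ => htle (hy i).1)
      · exact hle (h𝔥 h.2)
    · exact gen₀ h hh₀ _ (bracketClosed_generated _) (subset_generated _ (by simp))
        fun k => hmem (Sum.inl k)

/-! ### Weight vectors, and generation of sl(n) from one row and one column. -/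

section General

variable {F : Type*} [Field F] {n : ℕ}

theorem end_sub_smul (a b : F) (A : Module.End F (Grassmann F n)) :
    (a - b) • A = a • A - b • A := sub_smul a b A

/-- The coordinates `c_i` as linear functions on a subspace of diagonal vector fields. -/
def coordOn (𝔥 : Submodule F (Module.End F (Grassmann F n))) (i : Fin n) : Module.Dual F 𝔥 :=
  coord i ∘ₗ 𝔥.subtype

theorem coordOn_apply (𝔥 : Submodule F (Module.End F (Grassmann F n))) (i : Fin n) (h : 𝔥) :
    coordOn 𝔥 i h = coord i (h : Module.End F (Grassmann F n)) := rfl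

theorem diag_coordOn {𝔥 : Submodule F (Module.End F (Grassmann F n))} (h𝔥 : 𝔥 ≤ cartanW F n)
    (h : 𝔥) : diag (fun i => coordOn 𝔥 i h) = (h : Module.End F (Grassmann F n)) :=
  diag_coord_of_mem_cartanW (h𝔥 h.2)

variable [CharZero F]

theorem bracket_fpd_of_eigenvector {𝔥 : Submodule F (Module.End F (Grassmann F n))}
    (h𝔥 : 𝔥 ≤ cartanW F n) (h : 𝔥) {f : Grassmann F n} {γ : Module.Dual F 𝔥}
    (hf : diag (fun i => coordOn 𝔥 i h) f = γ h • f) (j : Fin n) :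
    superBracket (h : Module.End F (Grassmann F n)) (fpd F f j) =
      (γ - coordOn 𝔥 j) h • fpd F f j := by
  rw [← diag_coordOn h𝔥 h, bracket_diag_fpd, hf, fpd_smul, LinearMap.sub_apply, end_sub_smul]

theorem bracket_fpd_mono {𝔥 : Submodule F (Module.End F (Grassmann F n))}
    (h𝔥 : 𝔥 ≤ cartanW F n) (h : 𝔥) (u : Finset (Fin n)) (j : Fin n) :
    superBracket (h : Module.End F (Grassmann F n)) (fpd F (mono F u) j) =
      (∑ i ∈ u, coordOn 𝔥 i - coordOn 𝔥 j) h • fpd F (mono F u) j :=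
  bracket_fpd_of_eigenvector h𝔥 h (by rw [diag_mono]; simp) j

theorem isWeightVector_fpd_mono {𝔥 V : Submodule F (Module.End F (Grassmann F n))}
    (h𝔥 : 𝔥 ≤ cartanW F n) {u : Finset (Fin n)} {j : Fin n} (hV : fpd F (mono F u) j ∈ V) :
    IsWeightVector 𝔥 V (∑ i ∈ u, coordOn 𝔥 i - coordOn 𝔥 j) (fpd F (mono F u) j) :=
  ⟨hV, fpd_ne_zero (mono_ne_zero u) j, fun h => bracket_fpd_mono h𝔥 h u j⟩

omit [CharZero F] in
theorem fpd_mem_of_homog {V : Submodule F (Module.End F (Grassmann F n))} {k : ℕ} {i : Fin n}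
    (h : ∀ u : Finset (Fin n), u.card = k → fpd F (mono F u) i ∈ V) {f : Grassmann F n}
    (hf : f ∈ homog F n k) : fpd F f i ∈ V :=
  (homog_le (V := V.comap (fpdL i)) h) hf

/-- [ξ_a∂_j, f∂_a] = ξ_a(∂_j f)∂_a - f∂_j, and the first term vanishes by assumption. This moves a
coefficient from ∂_a to ∂_j. -/
theorem fpd_mem_transfer {N : Submodule F (Module.End F (Grassmann F n))} (hN : BracketClosed N)
    {a j : Fin n} {f : Grassmann F n} (h : fpd F (xi F a) j ∈ N) (hf : fpd F f a ∈ N)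
    (h0 : xi F a * pd F j f = 0) : fpd F f j ∈ N := by
  have := hN _ h _ hf
  rw [bracket_fpd_fpd, h0] at this
  simpa [fpd_neg] using this

theorem fpd_mono_mem_transfer {N : Submodule F (Module.End F (Grassmann F n))}
    (hN : BracketClosed N) (h : ∀ i j : Fin n, i ≠ j → fpd F (xi F i) j ∈ N)
    {u : Finset (Fin n)} {a j : Fin n} (ha : a ∈ u) (hf : fpd F (mono F u) a ∈ N) :
    fpd F (mono F u) j ∈ N := by
  by_cases haj : a = j
  · exact haj ▸ hf
  · exact fpd_mem_transfer hN (h a j haj) hf (xi_mul_pd_mono_of_mem haj ha)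

/-- Matrix units: [ξ_i∂_a, ξ_a∂_j] = ξ_i∂_j for i ≠ j. -/
theorem fpd_xi_mem_of_star {N : Submodule F (Module.End F (Grassmann F n))}
    (hN : BracketClosed N) {a : Fin n} (h1 : ∀ j, j ≠ a → fpd F (xi F a) j ∈ N)
    (h2 : ∀ j, j ≠ a → fpd F (xi F j) a ∈ N) {i j : Fin n} (hij : i ≠ j) :
    fpd F (xi F i) j ∈ N := by
  by_cases hi : i = a
  · exact hi ▸ h1 j (hi ▸ hij.symm)
  by_cases hj : j = a
  · exact hj ▸ h2 i hi
  have := hN _ (h2 i hi) _ (h1 j hj)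
  rw [bracket_fpd_fpd] at this
  simpa [hij.symm] using this

theorem fpd_xi_sub_mem_of_star {N : Submodule F (Module.End F (Grassmann F n))}
    (hN : BracketClosed N) {a : Fin n} (h1 : ∀ j, j ≠ a → fpd F (xi F a) j ∈ N)
    (h2 : ∀ j, j ≠ a → fpd F (xi F j) a ∈ N) (i : Fin n) :
    fpd F (xi F i) i - fpd F (xi F a) a ∈ N := by
  by_cases hi : i = a
  · simp [hi]
  have := hN _ (h2 i hi) _ (h1 i hi)
  rw [bracket_fpd_fpd] at this
  simpa [fpd_neg, sub_eq_add_neg] using this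

/-- The sum of the indices of `Fin n`. -/
def indexSum (n : ℕ) : ℤ := ∑ j : Fin n, (j.val : ℤ)

theorem three_le_indexSum (hn : 3 ≤ n) : 3 ≤ indexSum n := by
  obtain ⟨k, rfl⟩ := Nat.exists_eq_add_of_le' hn
  rw [indexSum, Fin.sum_univ_succ, Fin.sum_univ_succ, Fin.sum_univ_succ]
  have : 0 ≤ ∑ i : Fin k, ((i.succ.succ.succ).val : ℤ) :=
    Finset.sum_nonneg fun _ _ => Int.natCast_nonneg _
  simp only [Fin.val_zero, Fin.val_succ] at *
  push_cast at *
  omega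

/-- The diagonal entries of a traceless matrix that separates the weights used for `W`, `S` and
`S̃`. -/
def sepDiag (n : ℕ) (i : Fin n) : ℤ := if i.val = 0 then -indexSum n else i.val

theorem sum_sepDiag (hn : 0 < n) : ∑ i, sepDiag n i = 0 := by
  obtain ⟨k, rfl⟩ := Nat.exists_eq_add_of_le' hn
  simp [sepDiag, indexSum, Fin.sum_univ_succ]

variable (F) in
/-- The diagonal vector field with entries `sepDiag`. -/
def sepField (n : ℕ) : Module.End F (Grassmann F n) := diag fun i => (sepDiag n i : F)

omit [CharZero F] in
theorem coord_sepField (i : Fin n) : coord i (sepField F n) = sepDiag n i := coord_diag _ _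

variable (F) in
/-- The root vectors in the row and the column of index `a`. -/
def starVec (a : Fin n) : {j // j ≠ a} ⊕ {j // j ≠ a} → Module.End F (Grassmann F n) :=
  Sum.elim (fun j => fpd F (mono F {a}) j) (fun j => fpd F (mono F {j.1}) a)

/-- The weights of `starVec`. -/
def starWt (𝔥 : Submodule F (Module.End F (Grassmann F n))) (a : Fin n) :
    {j // j ≠ a} ⊕ {j // j ≠ a} → Module.Dual F 𝔥 :=
  Sum.elim (fun j => ∑ i ∈ {a}, coordOn 𝔥 i - coordOn 𝔥 j)
    (fun j => ∑ i ∈ {j.1}, coordOn 𝔥 i - coordOn 𝔥 a)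

/-- The values of `starWt` at `sepField`. -/
def starVal (a : Fin n) : {j // j ≠ a} ⊕ {j // j ≠ a} → ℤ :=
  Sum.elim (fun j => -indexSum n - j.1.val) (fun j => indexSum n + j.1.val)

theorem bracket_starVec {𝔥 : Submodule F (Module.End F (Grassmann F n))} (h𝔥 : 𝔥 ≤ cartanW F n)
    {a : Fin n} (k : {j // j ≠ a} ⊕ {j // j ≠ a}) (h : 𝔥) :
    superBracket (h : Module.End F (Grassmann F n)) (starVec F a k) =
      starWt 𝔥 a k h • starVec F a k := by
  rcases k with j | j
  · exact bracket_fpd_mono h𝔥 h _ _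
  · exact bracket_fpd_mono h𝔥 h _ _

omit [CharZero F] in
theorem starWt_sepField {𝔥 : Submodule F (Module.End F (Grassmann F n))} {a : Fin n}
    (ha : a.val = 0) (hs : sepField F n ∈ 𝔥) (k : {j // j ≠ a} ⊕ {j // j ≠ a}) :
    starWt 𝔥 a k ⟨sepField F n, hs⟩ = starVal a k := by
  rcases k with ⟨j, hj⟩ | ⟨j, hj⟩ <;>
    simp [starWt, starVal, coordOn_apply, coord_sepField, sepDiag, ha,
      show j.val ≠ 0 from fun h => hj (Fin.ext (h.trans ha.symm))]
  ring

theorem starVal_injective (hn : 3 ≤ n) {a : Fin n} : Function.Injective (starVal a) := by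
  have := three_le_indexSum hn
  rintro (⟨j, hj⟩ | ⟨j, hj⟩) (⟨k, hk⟩ | ⟨k, hk⟩) h <;> simp [starVal] at h <;>
    first
    | (congr 2; ext; omega)
    | (exfalso; omega)

/-- The index sum is at least 3 and j at least 1. The root weights therefore stay away from the
values -1, -2 and 0 that the vectors of L₋₁ and L_t take at `sepField`. -/
theorem lt_abs_starVal (hn : 3 ≤ n) {a : Fin n} (ha : a.val = 0)
    (k : {j // j ≠ a} ⊕ {j // j ≠ a}) : 3 < starVal a k ∨ starVal a k < -3 := by
  have := three_le_indexSum hn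
  rcases k with ⟨j, hj⟩ | ⟨j, hj⟩ <;> simp only [starVal, Sum.elim_inl, Sum.elim_inr] <;>
    have h0 : j.val ≠ 0 := fun h => hj (Fin.ext (h.trans ha.symm))
  · right; omega
  · left; omega

end General

/-! ### The algebra W(n). -/

section TypeW

variable {F : Type*} [Field F] {n : ℕ} [CharZero F]

theorem mem_part_iff (q : ZMod 2) (a : Grassmann F n) :
    a ∈ part F n q ↔ parity F n a = (-1 : F) ^ q.val • a := by
  have h0 : ∀ b ∈ part F n 0, parity F n b = b := fun b hb =>
    CliffordAlgebra.involute_eq_of_mem_even hb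
  have h1 : ∀ b ∈ part F n 1, parity F n b = -b := fun b hb =>
    CliffordAlgebra.involute_eq_of_mem_odd hb
  have hv : (1 : ZMod 2).val = 1 := rfl
  have htop : a ∈ part F n 0 ⊔ part F n 1 :=
    (CliffordAlgebra.evenOdd_isCompl (Q := (0 : QuadraticForm F (Fin n → F)))).sup_eq_top ▸
      Submodule.mem_top
  obtain ⟨a0, ha0, a1, ha1, rfl⟩ := Submodule.mem_sup.1 htop
  have hz : ∀ b : Grassmann F n, b = -b → b = 0 := fun b hb => by
    have h : (2 : F) • b = 0 := by rw [two_smul]; nth_rewrite 1 [hb]; simp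
    simpa using h
  obtain rfl | rfl : q = 0 ∨ q = 1 := by revert q; decide
  · refine ⟨fun h => by simpa using h0 _ h, fun h => ?_⟩
    rw [map_add, h0 _ ha0, h1 _ ha1] at h
    have : a1 = 0 := hz _ (by simpa using h.symm)
    simpa [this] using ha0
  · refine ⟨fun h => by rw [h1 _ h, hv]; simp [add_comm], fun h => ?_⟩
    rw [map_add, h0 _ ha0, h1 _ ha1, hv] at h
    have : a0 = 0 := hz _ (by simpa [add_comm] using h)
    simpa [this] using ha1

omit [CharZero F] in
theorem neg_one_pow_add (p q : ZMod 2) :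
    (-1 : F) ^ (p + q).val = (-1 : F) ^ p.val * (-1 : F) ^ q.val := by
  have hv : (1 : ZMod 2).val = 1 := rfl
  have h2 : (1 + 1 : ZMod 2) = 0 := rfl
  obtain rfl | rfl : p = 0 ∨ p = 1 := by revert p; decide
  · simp
  · obtain rfl | rfl : q = 0 ∨ q = 1 := by revert q; decide
    · simp
    · simp [hv, h2]

theorem fpd_mem_superDer {p : ZMod 2} {f : Grassmann F n} (hf : f ∈ part F n (p + 1))
    (i : Fin n) : fpd F f i ∈ superDer F n p := by
  have hv : (1 : ZMod 2).val = 1 := rfl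
  rw [mem_part_iff, neg_one_pow_add, hv] at hf
  constructor
  · intro q a ha
    rw [mem_part_iff] at ha ⊢
    have hpd : parity F n (pd F i a) = -((-1 : F) ^ q.val • pd F i a) := by
      rw [← map_smul, ← ha, pd_parity, neg_neg]
    rw [fpd_apply, parity_mul, hf, neg_one_pow_add, hpd]
    simp [smul_smul, mul_comm]
  · intro q a ha b
    rw [mem_part_iff] at ha
    rw [fpd_apply, fpd_apply, fpd_apply, pd_mul, mul_add, ← mul_assoc, ← mul_assoc]
    congr 1
    have hp : p = 0 ∨ p = 1 := by clear hf; revert p; decide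
    obtain rfl | rfl := hp
    · rw [mul_eq_mul_of_odd (a := f) (by simpa using hf), parity_parity]
      simp [mul_assoc]
    · rw [mul_eq_mul_of_even (a := f) (by simpa [hv] using hf), ha]
      simp [mul_assoc]

/-- A superderivation is determined by its values on the ξ_i; the identity propagates under left
multiplication by generators. -/
theorem eq_sum_fpd_of_mem_superDer {p : ZMod 2} {D : Module.End F (Grassmann F n)}
    (hD : D ∈ superDer F n p) : D = ∑ i, fpd F (D (xi F i)) i := by
  have hv : (1 : ZMod 2).val = 1 := rfl
  have h1 : ∀ q, ∀ a ∈ part F n q, D a ∈ part F n (p + q) := hD.1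
  have h2 : ∀ q, ∀ a ∈ part F n q, ∀ b,
    D (a * b) = D a * b + (-1 : F) ^ (p * q).val • (a * D b) := hD.2
  refine LinearMap.ext fun a => ?_
  induction a using grassmann_induction with
  | one =>
    have h := h2 0 1 ((mem_part_iff _ _).2 (by simp)) 1
    simp only [mul_one, mul_zero, ZMod.val_zero, pow_zero, one_smul, one_mul, left_eq_add] at h
    simp [LinearMap.sum_apply, fpd_apply, h]
  | add a b ha hb => rw [map_add, map_add, ha, hb]
  | smul c a ha => rw [map_smul, map_smul, ha]
  | mul j a ha =>
    have hxi : xi F j ∈ part F n 1 := (mem_part_iff _ _).2 (by simp [hv])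
    rw [h2 1 _ hxi, ha, LinearMap.sum_apply, LinearMap.sum_apply, Finset.mul_sum,
      Finset.smul_sum]
    have hterm : ∀ i, fpd F (D (xi F i)) i (xi F j * a) = (if i = j then D (xi F i) * a else 0) +
        (-1 : F) ^ (p * 1).val • (xi F j * fpd F (D (xi F i)) i a) := by
      intro i
      have hi := h1 1 (xi F i) ((mem_part_iff _ _).2 (by simp [hv]))
      rw [mem_part_iff, neg_one_pow_add, hv] at hi
      rw [fpd_apply, fpd_apply, pd_xi_mul, mul_sub, ← mul_assoc (D (xi F i)), mul_xi, hi]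
      split_ifs <;> simp [mul_assoc]
    simp only [hterm, Finset.sum_add_distrib, Finset.sum_ite_eq', Finset.mem_univ, if_true]

theorem W_eq_span : W F n =
    Submodule.span F {D | ∃ (u : Finset (Fin n)) (i : Fin n), D = fpd F (mono F u) i} := by
  refine le_antisymm (iSup_le fun p D hD => ?_) (Submodule.span_le.2 ?_)
  · rw [eq_sum_fpd_of_mem_superDer hD]
    refine Submodule.sum_mem _ fun i _ => ?_
    have : ∀ f : Grassmann F n, f ∈ (Submodule.span F {D : Module.End F (Grassmann F n) |
        ∃ (u : Finset (Fin n)) (i : Fin n), D = fpd F (mono F u) i}).comap (fpdL i) := by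
      rw [← Submodule.eq_top_iff', eq_top_iff, ← span_mono, Submodule.span_le]
      rintro _ ⟨u, rfl⟩
      exact Submodule.subset_span ⟨u, i, rfl⟩
    exact this _
  · rintro _ ⟨u, i, rfl⟩
    obtain ⟨p, hp⟩ : ∃ p : ZMod 2, mono F u ∈ part F n (p + 1) := by
      have hv : (1 : ZMod 2).val = 1 := rfl
      have h2 : (1 + 1 : ZMod 2) = 0 := rfl
      rcases neg_one_pow_eq_or F u.card with h | h
      · exact ⟨1, by rw [mem_part_iff, parity_mono, h, h2]; simp⟩
      · exact ⟨0, by rw [mem_part_iff, parity_mono, h, zero_add, hv]; simp⟩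
    exact Submodule.mem_iSup_of_mem (p := superDer F n) p (fpd_mem_superDer hp i)

theorem fpd_mem_W (f : Grassmann F n) (i : Fin n) : fpd F f i ∈ W F n := by
  have : ⊤ ≤ (W F n).comap (fpdL i) := by
    rw [← span_mono, Submodule.span_le]
    rintro _ ⟨u, rfl⟩
    rw [W_eq_span]
    exact Submodule.subset_span ⟨u, i, rfl⟩
  exact this Submodule.mem_top

theorem bracketClosed_W : BracketClosed (W F n) := by
  have h : BracketClosed (Submodule.span F {D : Module.End F (Grassmann F n) |
      ∃ (u : Finset (Fin n)) (i : Fin n), D = fpd F (mono F u) i}) :=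
    bracketClosed_span (by
      rintro _ ⟨u, i, rfl⟩ _ ⟨v, j, rfl⟩
      rw [← W_eq_span, bracket_fpd_fpd]
      exact add_mem (fpd_mem_W _ _) (fpd_mem_W _ _))
  rwa [← W_eq_span] at h

omit [CharZero F] in
theorem fpd_mem_Wdeg {k : ℕ} {f : Grassmann F n} (hf : f ∈ homog F n k) (i : Fin n) {d : ℤ}
    (hd : (k : ℤ) = d + 1) : fpd F f i ∈ Wdeg F n d :=
  fpd_mem_of_homog (V := Wdeg F n d)
    (fun u hu => Submodule.subset_span ⟨u, i, by rw [hu, hd], rfl⟩) hf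

theorem bracketClosed_Wdeg_zero : BracketClosed (Wdeg F n 0) := by
  refine bracketClosed_span ?_
  rintro _ ⟨u, i, hu, rfl⟩ _ ⟨v, j, hv, rfl⟩
  have hu' := mono_mem_homog (F := F) (u := u) (k := 0 + 1) (by exact_mod_cast hu)
  have hv' := mono_mem_homog (F := F) (u := v) (k := 0 + 1) (by exact_mod_cast hv)
  rw [bracket_fpd_fpd]
  exact add_mem (fpd_mem_Wdeg (mul_mem_homog hu' (pd_mem_homog hv' i)) j (by simp))
    (fpd_mem_Wdeg (mul_mem_homog (pd_mem_homog (parity_mem_homog hu') j) hv') i (by simp))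

theorem Wdeg_le_W (d : ℤ) : Wdeg F n d ≤ W F n :=
  Submodule.span_le.2 (by rintro _ ⟨u, i, -, rfl⟩; exact fpd_mem_W _ _)

/-- Since [∂_i, f∂_j] = (∂_i f)∂_j, every monomial is reached from the top one by deleting
variables; induction on the size of the complement. -/
theorem fpd_mono_mem_of_univ {N : Submodule F (Module.End F (Grassmann F n))}
    (hN : BracketClosed N) (h1 : ∀ j, fpd F 1 j ∈ N) (h2 : ∀ j, fpd F (mono F Finset.univ) j ∈ N)
    (u : Finset (Fin n)) (j : Fin n) : fpd F (mono F u) j ∈ N := by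
  induction hk : uᶜ.card generalizing u with
  | zero =>
    rw [Finset.card_eq_zero, Finset.compl_eq_empty_iff] at hk
    exact hk ▸ h2 j
  | succ k ih =>
    obtain ⟨i, hi⟩ : uᶜ.Nonempty := Finset.card_pos.1 (by omega)
    have := hN _ (h1 i) _ (ih (insert i u) (by
      rw [Finset.compl_insert, Finset.card_erase_of_mem hi, hk]; rfl))
    have hi' : i ∉ u := Finset.mem_compl.1 hi
    rw [bracket_fpd_fpd] at this
    rcases pd_mono_of_mem (F := F) (Finset.mem_insert_self i u) with h | h <;>
      simpa [h, Finset.erase_insert hi', fpd_neg] using this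

theorem hasCartanGenerators_W (hn : 3 ≤ n) : HasCartanGenerators 1 (W F n) (Wdeg F n (-1))
    (Wdeg F n 0) (Wdeg F n (n - 1)) (cartanW F n) := by
  classical
  obtain ⟨a, ha⟩ : ∃ a : Fin n, a.val = 0 := ⟨⟨0, by omega⟩, rfl⟩
  obtain ⟨a₁, ha₁⟩ : ∃ a : Fin n, a.val = 1 := ⟨⟨1, by omega⟩, rfl⟩
  obtain ⟨a₂, ha₂⟩ : ∃ a : Fin n, a.val = 2 := ⟨⟨2, by omega⟩, rfl⟩
  have hs : sepField F n ∈ cartanW F n := diag_mem_cartanW _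
  have hsum : ∑ i, (sepDiag n i : F) = 0 := by exact_mod_cast sum_sepDiag (n := n) (by omega)
  -- The root vectors only generate sl(n), whereas L₀ is gl(n). Putting 0 and the trace into Φ
  -- forces a generic `h` to have nonzero trace.
  let tr : Module.Dual F (cartanW F n) := ∑ i, coordOn (cartanW F n) i
  have htr : tr ≠ 0 := fun h => by
    have := LinearMap.congr_fun h ⟨_, diag_mem_cartanW (Pi.single a 1)⟩
    simp [tr, LinearMap.sum_apply, coordOn_apply, coord_diag] at this
  refine hasCartanGenerators_of (starWt _ a) (starVec F a) _ (fpd F (mono F ∅) a₁) _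
    (fun _ => fpd F (mono F Finset.univ) a₂) {0, tr}
    (isWeightVector_fpd_mono le_rfl (fpd_mem_Wdeg (mono_mem_homog Finset.card_empty) _ rfl))
    (fun _ => isWeightVector_fpd_mono le_rfl
      (fpd_mem_Wdeg (mono_mem_homog (Finset.card_univ.trans (Fintype.card_fin n))) _ (by ring)))
    (bracket_starVec le_rfl) ?_ ⟨sepField F n, hs⟩ (starVal a) (-1) (fun _ => -2)
    (starWt_sepField ha hs) ?_ ?_ (starVal_injective hn) (fun _ _ _ => Subsingleton.elim _ _)
    (by simp) (fun k => by have := lt_abs_starVal hn ha k; omega)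
    (fun k _ => by have := lt_abs_starVal hn ha k; omega) bracketClosed_Wdeg_zero bracketClosed_W
    ?_ (Wdeg_le_W _) (Wdeg_le_W _) (Wdeg_le_W _) ?_ ?_
  · rintro (j | j) <;>
      exact fpd_mem_Wdeg (mono_mem_homog (Finset.card_singleton _)) _ rfl
  · simp [coordOn_apply, coord_sepField, sepDiag, ha₁]
  -- The top monomial has weight the trace, which is 0 at `sepField`; subtracting the entry 2 of
  -- index `a₂` gives -2.
  · simp [coordOn_apply, coord_sepField, LinearMap.sum_apply, hsum]
    simp [sepDiag, ha₂]
  · refine Submodule.span_le.2 ?_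
    rintro _ ⟨i, rfl⟩
    exact fpd_mem_Wdeg (xi_mem_homog i) i rfl
  · intro h hΩ N hN hh hstar
    have h1 : ∀ j, j ≠ a → fpd F (xi F a) j ∈ N := fun j hj => by
      simpa [starVec] using hstar (Sum.inl ⟨j, hj⟩)
    have h2 : ∀ j, j ≠ a → fpd F (xi F j) a ∈ N := fun j hj => by
      simpa [starVec] using hstar (Sum.inr ⟨j, hj⟩)
    have h3 := fpd_xi_sub_mem_of_star hN h1 h2
    have htrh : tr h ≠ 0 := fun h0 =>
      hΩ tr (by simp) 0 (by simp) htr (by simpa using h0)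
    have h4 : fpd F (xi F a) a ∈ N := by
      -- Modulo the traceless diagonal fields already in `N`, `h` is a nonzero multiple of ξ_a∂_a.
      have h5 : (h : Module.End F (Grassmann F n)) =
          ∑ i, coordOn _ i h • (fpd F (xi F i) i - fpd F (xi F a) a) +
            tr h • fpd F (xi F a) a := by
        conv_lhs => rw [← diag_coordOn le_rfl h, diag]
        simp only [smul_sub, Finset.sum_sub_distrib, tr, LinearMap.sum_apply, Finset.sum_smul]
        abel
      have h6 : tr h • fpd F (xi F a) a ∈ N := by
        rw [h5] at hh
        exact (Submodule.add_mem_iff_right _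
          (Submodule.sum_mem _ fun i _ => Submodule.smul_mem _ _ (h3 i))).1 hh
      exact (Submodule.smul_mem_iff _ htrh).1 h6
    refine Submodule.span_le.2 ?_
    rintro _ ⟨u, j, hu, rfl⟩
    obtain ⟨i, rfl⟩ := Finset.card_eq_one.1 (show u.card = 1 by exact_mod_cast hu)
    rw [mono_singleton]
    by_cases hij : i = j
    · subst hij
      simpa using add_mem (h3 i) h4
    · exact fpd_xi_mem_of_star hN h1 h2 hij
  · intro N hN h0 hx hy
    have h1 : ∀ i j : Fin n, i ≠ j → fpd F (xi F i) j ∈ N := fun i j _ =>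
      h0 (fpd_mem_Wdeg (xi_mem_homog i) j rfl)
    rw [W_eq_span]
    refine Submodule.span_le.2 ?_
    rintro _ ⟨u, j, rfl⟩
    refine fpd_mono_mem_of_univ hN (fun j => ?_)
      (fun j => fpd_mono_mem_transfer hN h1 (Finset.mem_univ a₂) (hy 0)) u j
    by_cases hj : a₁ = j
    · simpa [hj] using hx
    · exact fpd_mem_transfer hN (h1 _ _ hj) (by simpa using hx) (by simp)

end TypeW

/-! ### The algebra S(n). -/

section TypeS

variable {F : Type*} [Field F] {n : ℕ}

/-- `Dij` as a linear map. -/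
def DijL (i j : Fin n) : Grassmann F n →ₗ[F] Module.End F (Grassmann F n) :=
  fpdL j ∘ₗ pd F i + fpdL i ∘ₗ pd F j

theorem DijL_apply (i j : Fin n) (f : Grassmann F n) : DijL i j f = Dij F i j f := rfl

theorem Dij_neg (i j : Fin n) (f : Grassmann F n) : Dij F i j (-f) = -Dij F i j f :=
  map_neg (DijL i j) f

theorem Dij_comm (i j : Fin n) (f : Grassmann F n) : Dij F i j f = Dij F j i f := add_comm _ _

theorem Dij_mem_Sdeg {k : ℕ} {f : Grassmann F n} (hf : f ∈ homog F n k) (i j : Fin n) {d : ℤ}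
    (hd : (k : ℤ) = d + 2) : Dij F i j f ∈ Sdeg F n d :=
  (homog_le (V := (Sdeg F n d).comap (DijL i j)) fun u hu =>
    Submodule.subset_span ⟨u, i, j, by rw [hu, hd], rfl⟩) hf

theorem S_eq_span : S F n = Submodule.span F {D | ∃ (u : Finset (Fin n)) (i j : Fin n),
    D = Dij F i j (mono F u)} := by
  refine le_antisymm (iSup₂_le fun k _ => Submodule.span_mono ?_) (Submodule.span_le.2 ?_)
  · rintro _ ⟨u, i, j, -, rfl⟩
    exact ⟨u, i, j, rfl⟩
  · rintro _ ⟨u, i, j, rfl⟩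
    rcases u.eq_empty_or_nonempty with rfl | hu
    · have : Dij F i j (mono F (∅ : Finset (Fin n))) = 0 := by simp [Dij]
      rw [this]
      exact zero_mem _
    · have h1 := u.card_le_univ
      have h2 := hu.card_pos
      rw [Fintype.card_fin] at h1
      refine Submodule.mem_iSup_of_mem (u.card - 2 : ℤ) (Submodule.mem_iSup_of_mem ?_
        (Dij_mem_Sdeg (mono_mem_homog rfl) i j (by ring)))
      constructor <;> omega

theorem Dij_mem_S (i j : Fin n) (f : Grassmann F n) : Dij F i j f ∈ S F n := by
  have : ⊤ ≤ (S F n).comap (DijL i j) := by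
    rw [← span_mono, Submodule.span_le]
    rintro _ ⟨u, rfl⟩
    rw [S_eq_span]
    exact Submodule.subset_span ⟨u, i, j, rfl⟩
  exact this Submodule.mem_top

theorem Sdeg_le_S (d : ℤ) : Sdeg F n d ≤ S F n :=
  Submodule.span_le.2 (by rintro _ ⟨u, i, j, -, rfl⟩; exact Dij_mem_S _ _ _)

theorem cartanS_le_cartanW : cartanS F n ≤ cartanW F n :=
  Submodule.span_le.2 (by
    rintro _ ⟨i, j, rfl⟩
    exact sub_mem (Submodule.subset_span ⟨i, rfl⟩) (Submodule.subset_span ⟨j, rfl⟩))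

theorem diag_mem_cartanS {c : Fin n → F} (hc : ∑ i, c i = 0) : diag c ∈ cartanS F n := by
  rcases isEmpty_or_nonempty (Fin n) with _ | ⟨⟨a⟩⟩
  · simp [diag]
  · have : diag c = ∑ i, c i • (fpd F (xi F i) i - fpd F (xi F a) a) := by
      simp only [smul_sub, Finset.sum_sub_distrib, ← Finset.sum_smul, hc, zero_smul, sub_zero,
        diag]
    rw [this]
    exact Submodule.sum_mem _ fun i _ =>
      Submodule.smul_mem _ _ (Submodule.subset_span ⟨i, a, rfl⟩)

theorem sum_coordOn_cartanS (h : cartanS F n) : ∑ i, coordOn (cartanS F n) i h = 0 := by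
  have : cartanS F n ≤ LinearMap.ker (∑ i, coord (F := F) i) := by
    refine Submodule.span_le.2 ?_
    rintro _ ⟨i, j, rfl⟩
    simp [LinearMap.sum_apply, coord_fpd_xi]
  simpa [LinearMap.sum_apply, coordOn_apply] using this h.2

variable [CharZero F]

/-- When the right side is expanded by the Leibniz rule, the surplus terms with ∂_c∂_d g or ∂_a∂_b f
occur in pairs of opposite sign. Closure of S follows without mentioning divergence. -/
theorem bracket_Dij_Dij (a b c d : Fin n) (f g : Grassmann F n) :
    superBracket (Dij F a b f) (Dij F c d g) =
      Dij F a c (parity F n (pd F b f) * pd F d g) + Dij F a d (parity F n (pd F b f) * pd F c g) +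
      Dij F b c (parity F n (pd F a f) * pd F d g) +
      Dij F b d (parity F n (pd F a f) * pd F c g) := by
  simp only [Dij, add_bracket, bracket_add, bracket_fpd_fpd, pd_mul, parity_parity, fpd_add,
    pd_parity, fpd_neg, neg_mul]
  rw [pd_pd d c g, pd_pd b a f]
  simp only [map_neg, neg_mul, mul_neg, fpd_neg]
  abel

theorem bracketClosed_S : BracketClosed (S F n) := by
  have h : BracketClosed (Submodule.span F {D : Module.End F (Grassmann F n) |
      ∃ (u : Finset (Fin n)) (i j : Fin n), D = Dij F i j (mono F u)}) :=
    bracketClosed_span (by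
      rintro _ ⟨u, i, j, rfl⟩ _ ⟨v, k, l, rfl⟩
      rw [← S_eq_span, bracket_Dij_Dij]
      exact add_mem (add_mem (add_mem (Dij_mem_S _ _ _) (Dij_mem_S _ _ _)) (Dij_mem_S _ _ _))
        (Dij_mem_S _ _ _))
  rwa [← S_eq_span] at h

theorem bracketClosed_Sdeg_zero : BracketClosed (Sdeg F n 0) := by
  refine bracketClosed_span ?_
  rintro _ ⟨u, i, j, hu, rfl⟩ _ ⟨v, k, l, hv, rfl⟩
  have hu' := mono_mem_homog (F := F) (u := u) (k := 1 + 1) (by exact_mod_cast hu)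
  have hv' := mono_mem_homog (F := F) (u := v) (k := 1 + 1) (by exact_mod_cast hv)
  have key : ∀ p q r s : Fin n, Dij F r s (parity F n (pd F p (mono F u)) * pd F q (mono F v)) ∈
      Sdeg F n 0 := fun p q r s =>
    Dij_mem_Sdeg (mul_mem_homog (parity_mem_homog (pd_mem_homog hu' p)) (pd_mem_homog hv' q)) r s
      (by simp)
  rw [bracket_Dij_Dij]
  exact add_mem (add_mem (add_mem (key _ _ _ _) (key _ _ _ _)) (key _ _ _ _)) (key _ _ _ _)

/-- D_jj(ξ_j x^u) = 2x^u∂_j up to sign, and 2 is invertible. -/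
theorem fpd_mem_Sdeg {u : Finset (Fin n)} {j : Fin n} (hj : j ∉ u) {d : ℤ}
    (hd : (u.card : ℤ) = d + 1) : fpd F (mono F u) j ∈ Sdeg F n d := by
  have h1 : Dij F j j (mono F (insert j u)) ∈ Sdeg F n d :=
    Dij_mem_Sdeg (mono_mem_homog (Finset.card_insert_of_notMem hj)) j j (by push_cast; omega)
  have h2 : (2 : F) • fpd F (mono F u) j ∈ Sdeg F n d := by
    rcases pd_mono_of_mem (F := F) (Finset.mem_insert_self j u) with h | h <;>
      rw [Dij, h, Finset.erase_insert hj, ← two_smul F] at h1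
    · exact h1
    · rwa [fpd_neg, smul_neg, neg_mem_iff] at h1
  exact (Submodule.smul_mem_iff _ two_ne_zero).1 h2

theorem fpd_xi_mem_Sdeg {i j : Fin n} (hij : i ≠ j) : fpd F (xi F i) j ∈ Sdeg F n 0 := by
  simpa using fpd_mem_Sdeg (F := F) (u := {i}) (j := j) (by simpa using hij.symm) (d := 0)
    (by simp)

omit [CharZero F] in
theorem pair_mem_homog (i j : Fin n) : xi F i * xi F j ∈ homog F n 2 := by
  have := mul_mem_homog (xi_mem_homog (F := F) i) (xi_mem_homog j)
  rwa [one_add_one_eq_two] at this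

omit [CharZero F] in
theorem Dij_xi_mul_xi (i j a b : Fin n) : Dij F i j (xi F a * xi F b) =
    fpd F ((if i = a then xi F b else 0) - (if i = b then xi F a else 0)) j +
    fpd F ((if j = a then xi F b else 0) - (if j = b then xi F a else 0)) i := by
  simp [Dij, pd_xi_mul]

omit [CharZero F] in
theorem cartanS_le_Sdeg : cartanS F n ≤ Sdeg F n 0 := by
  refine Submodule.span_le.2 ?_
  rintro _ ⟨i, j, rfl⟩
  by_cases hij : i = j
  · simp [hij]
  · have := Dij_mem_Sdeg (pair_mem_homog (F := F) j i) i j (d := 0) rfl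
    rw [Dij_xi_mul_xi] at this
    simpa [hij, Ne.symm hij, fpd_neg, add_comm, sub_eq_add_neg] using this

omit [CharZero F] in
theorem mono_mem_of_xi_mul_xi_mem {V : Submodule F (Grassmann F n)}
    (h : ∀ a b, a ≠ b → xi F a * xi F b ∈ V) {u : Finset (Fin n)} (hu : u.card = 2) :
    mono F u ∈ V := by
  obtain ⟨a, b, hab, rfl⟩ := Finset.card_eq_two.1 hu
  refine mono_mem_of_prodXi_mem (l := [a, b]) (by simpa using hab) (by simp) ?_
  simpa [prodXi] using h a b hab

theorem Sdeg_zero_le_of_star {N : Submodule F (Module.End F (Grassmann F n))}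
    (hN : BracketClosed N) {a : Fin n} (h1 : ∀ j, j ≠ a → fpd F (xi F a) j ∈ N)
    (h2 : ∀ j, j ≠ a → fpd F (xi F j) a ∈ N) : Sdeg F n 0 ≤ N := by
  have h3 := fpd_xi_sub_mem_of_star hN h1 h2
  have h4 : ∀ i j : Fin n, i ≠ j → fpd F (xi F i) j ∈ N := fun i j =>
    fpd_xi_mem_of_star hN h1 h2
  refine Submodule.span_le.2 ?_
  rintro _ ⟨u, i, j, hu, rfl⟩
  refine mono_mem_of_xi_mul_xi_mem (V := N.comap (DijL i j)) (fun p q hpq => ?_)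
    (by exact_mod_cast hu)
  rw [Submodule.mem_comap, DijL_apply, Dij_xi_mul_xi]
  have hd : ∀ p q, fpd F (xi F p) p - fpd F (xi F q) q ∈ N := fun p q => by
    simpa using sub_mem (h3 p) (h3 q)
  by_cases hip : i = p
  · subst hip
    by_cases hjq : j = q
    · subst hjq
      simpa [hpq, hpq.symm, fpd_neg, sub_eq_add_neg] using hd j i
    · by_cases hji : j = i
      · subst hji
        simpa [hjq] using add_mem (h4 q j (Ne.symm hjq)) (h4 q j (Ne.symm hjq))
      · simpa [hjq, hji, hpq] using h4 q j (Ne.symm hjq)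
  · by_cases hiq : i = q
    · subst hiq
      by_cases hjp : j = p
      · subst hjp
        simpa [hip, Ne.symm hip, fpd_neg, add_comm, sub_eq_add_neg] using hd i j
      · by_cases hji : j = i
        · subst hji
          simpa [hip, fpd_neg] using
            add_mem (neg_mem (h4 p j (Ne.symm hip))) (neg_mem (h4 p j (Ne.symm hip)))
        · simpa [hip, hji, hjp, fpd_neg] using h4 p j (Ne.symm hjp)
    · by_cases hjp : j = p
      · subst hjp
        simpa [hip, hiq, hpq] using h4 q i (Ne.symm hiq)
      · by_cases hjq : j = q
        · subst hjq
          simpa [hip, hiq, hjp, fpd_neg] using h4 p i (Ne.symm hip)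
        · simp [hip, hiq, hjp, hjq]

/-- If ξ_a∂_b kills f, it acts on D_ij(f) only through the indices, turning an index a into b with a
minus sign. -/
theorem bracket_fpd_xi_Dij (a b i j : Fin n) (f : Grassmann F n) (hf : xi F a * pd F b f = 0) :
    superBracket (fpd F (xi F a) b) (Dij F i j f) =
      -(if i = a then Dij F b j f else 0) - (if j = a then Dij F i b f else 0) := by
  have h : ∀ k, xi F a * pd F b (pd F k f) = -(if k = a then pd F b f else 0) := fun k => by
    have := congrArg (pd F k) hf
    rw [pd_xi_mul, map_zero, sub_eq_zero] at this
    rw [pd_pd, mul_neg, ← this]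
  simp only [Dij, bracket_add, bracket_fpd_fpd, h, parity_xi, map_neg, pd_xi]
  split_ifs <;> simp [fpd_neg] <;> abel

/-- For fixed T the D_ij(T) behave like a symmetric square under the ξ_a∂_b: the square D_aa(T)
gives 2D_ab(T) and then all D_ij(T), changing one index at a time. -/
theorem Dij_univ_mem {N : Submodule F (Module.End F (Grassmann F n))}
    (hN : BracketClosed N) (h : ∀ i j : Fin n, i ≠ j → fpd F (xi F i) j ∈ N) {a : Fin n}
    (ha : Dij F a a (mono F Finset.univ) ∈ N) (i j : Fin n) :
    Dij F i j (mono F Finset.univ) ∈ N := by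
  have h0 : ∀ b, a ≠ b → xi F a * pd F b (mono F Finset.univ) = 0 := fun b hb =>
    xi_mul_pd_mono_of_mem hb (Finset.mem_univ a)
  have h1 : ∀ b, Dij F a b (mono F Finset.univ) ∈ N := by
    intro b
    by_cases hb : a = b
    · exact hb ▸ ha
    have := hN _ (h a b hb) _ ha
    rw [bracket_fpd_xi_Dij _ _ _ _ _ (h0 b hb), if_pos rfl, if_pos rfl, Dij_comm b a,
      ← neg_add', ← two_smul F] at this
    exact (Submodule.smul_mem_iff _ two_ne_zero).1 (neg_mem_iff.1 this)
  by_cases hi : a = i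
  · exact hi ▸ h1 j
  by_cases hj : a = j
  · exact hj ▸ Dij_comm (F := F) _ _ _ ▸ h1 i
  have := hN _ (h a i hi) _ (h1 j)
  rw [bracket_fpd_xi_Dij _ _ _ _ _ (h0 i hi), if_pos rfl, if_neg (Ne.symm hj)] at this
  simpa using this

theorem bracket_fpd_one_Dij (l i j : Fin n) (f : Grassmann F n) :
    superBracket (fpd F 1 l) (Dij F i j f) = -Dij F i j (pd F l f) := by
  simp only [Dij, bracket_add, bracket_fpd_fpd, parity_one, pd_one, zero_mul, fpd_zero, add_zero,
    one_mul, pd_pd l, fpd_neg, neg_add]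

-- Descent from the top monomial by deleting variables. The bound `d` is 0 for S and 2 for S̃, where
-- (1+T)∂_l acts as -∂_l only on D_ij(f) with f of degree at least 3.
omit [CharZero F] in
theorem Dij_mono_mem_of_univ {N : Submodule F (Module.End F (Grassmann F n))} {d : ℕ}
    (h1 : ∀ (l i j : Fin n) (u : Finset (Fin n)), d < u.card → Dij F i j (mono F u) ∈ N →
      Dij F i j (pd F l (mono F u)) ∈ N)
    (h2 : ∀ i j, Dij F i j (mono F Finset.univ) ∈ N) (u : Finset (Fin n)) (hu : d ≤ u.card)
    (i j : Fin n) : Dij F i j (mono F u) ∈ N := by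
  induction hk : uᶜ.card generalizing u with
  | zero =>
    rw [Finset.card_eq_zero, Finset.compl_eq_empty_iff] at hk
    exact hk ▸ h2 i j
  | succ k ih =>
    obtain ⟨l, hl⟩ : uᶜ.Nonempty := Finset.card_pos.1 (by omega)
    have hl' : l ∉ u := Finset.mem_compl.1 hl
    have hc : (insert l u).card = u.card + 1 := Finset.card_insert_of_notMem hl'
    have := h1 l i j (insert l u) (by omega) (ih (insert l u) (by omega) (by
      rw [Finset.compl_insert, Finset.card_erase_of_mem hl, hk]; rfl))
    rcases pd_mono_of_mem (F := F) (Finset.mem_insert_self l u) with h | h <;>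
      simpa [h, Finset.erase_insert hl', Dij_neg] using this

theorem sepField_mem_cartanS (hn : 0 < n) : sepField F n ∈ cartanS F n :=
  diag_mem_cartanS (by exact_mod_cast sum_sepDiag hn)

theorem hasCartanGenerators_S (hn : 4 ≤ n) : HasCartanGenerators 1 (S F n) (Sdeg F n (-1))
    (Sdeg F n 0) (Sdeg F n (n - 2)) (cartanS F n) := by
  classical
  obtain ⟨a, ha⟩ : ∃ a : Fin n, a.val = 0 := ⟨⟨0, by omega⟩, rfl⟩
  obtain ⟨a₁, ha₁⟩ : ∃ a : Fin n, a.val = 1 := ⟨⟨1, by omega⟩, rfl⟩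
  have hs : sepField F n ∈ cartanS F n := sepField_mem_cartanS (by omega)
  have hsum : ∑ i, (sepDiag n i : F) = 0 := by exact_mod_cast sum_sepDiag (n := n) (by omega)
  refine hasCartanGenerators_of (starWt _ a) (starVec F a) _ (fpd F (mono F ∅) a₁) _
    (fun _ => fpd F (mono F (Finset.univ.erase a₁)) a₁) ∅
    (isWeightVector_fpd_mono cartanS_le_cartanW (fpd_mem_Sdeg (by simp) rfl))
    (fun _ => isWeightVector_fpd_mono cartanS_le_cartanW (fpd_mem_Sdeg (by simp) ?_))
    (bracket_starVec cartanS_le_cartanW) ?_ ⟨sepField F n, hs⟩ (starVal a) (-1) (fun _ => -2)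
    (starWt_sepField ha hs) ?_ ?_ (starVal_injective (by omega))
    (fun _ _ _ => Subsingleton.elim _ _)
    (by simp) (fun k => by have := lt_abs_starVal (by omega) ha k; omega)
    (fun k _ => by have := lt_abs_starVal (by omega) ha k; omega) bracketClosed_Sdeg_zero
    bracketClosed_S cartanS_le_Sdeg (Sdeg_le_S _) (Sdeg_le_S _) (Sdeg_le_S _) ?_ ?_
  · rw [Finset.card_erase_of_mem (Finset.mem_univ _), Finset.card_univ, Fintype.card_fin]
    omega
  · rintro (⟨j, hj⟩ | ⟨j, hj⟩)
    · exact fpd_mem_Sdeg (by simpa using hj) rfl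
    · exact fpd_mem_Sdeg (by simpa using hj.symm) rfl
  · simp [coordOn_apply, coord_sepField, sepDiag, ha₁]
  · intro _
    -- The trace is 0, so the monomial without ξ_{a₁} has value -1, and ∂_{a₁} contributes another
    -- -1.
    have hsum' : ∑ i ∈ Finset.univ.erase a₁, (sepDiag n i : F) = -sepDiag n a₁ := by
      rw [← Finset.add_sum_erase _ _ (Finset.mem_univ a₁)] at hsum
      exact eq_neg_of_add_eq_zero_right hsum
    rw [LinearMap.sub_apply, LinearMap.sum_apply]
    simp only [coordOn_apply, coord_sepField, hsum']
    simp [sepDiag, ha₁]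
    norm_num
  · intro h _ N hN _ hstar
    exact Sdeg_zero_le_of_star hN (fun j hj => by simpa [starVec] using hstar (Sum.inl ⟨j, hj⟩))
      (fun j hj => by simpa [starVec] using hstar (Sum.inr ⟨j, hj⟩))
  · intro N hN h0 hx hy
    have h1 : ∀ i j : Fin n, i ≠ j → fpd F (xi F i) j ∈ N := fun i j hij =>
      h0 (fpd_xi_mem_Sdeg hij)
    have h2 : ∀ j, fpd F 1 j ∈ N := fun j => by
      by_cases hj : a₁ = j
      · simpa [hj] using hx
      · exact fpd_mem_transfer hN (h1 _ _ hj) (by simpa using hx) (by simp)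
    -- D_{a₁a₁}(T) is ±2 times the chosen vector of the top component.
    have h3 : Dij F a₁ a₁ (mono F Finset.univ) ∈ N := by
      rcases pd_mono_of_mem (F := F) (Finset.mem_univ a₁) with h | h <;> rw [Dij, h]
      · exact add_mem (hy 0) (hy 0)
      · rw [fpd_neg]
        exact add_mem (neg_mem (hy 0)) (neg_mem (hy 0))
    rw [S_eq_span]
    refine Submodule.span_le.2 ?_
    rintro _ ⟨u, i, j, rfl⟩
    refine Dij_mono_mem_of_univ (d := 0) (fun l i j u _ hu => ?_) (Dij_univ_mem hN h1 h3) u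
      (Nat.zero_le _) i j
    have := hN _ (h2 l) _ hu
    rw [bracket_fpd_one_Dij] at this
    exact neg_mem_iff.1 this

end TypeS

/-! ### The deformed algebra S̃(2m). -/

section TypeStilde

variable {F : Type*} [Field F] {m : ℕ}

theorem parity_top : parity F (2 * m) (mono F Finset.univ) = mono F Finset.univ := by
  simp [parity_mono]

theorem top_mem_homog : mono F (Finset.univ : Finset (Fin (2 * m))) ∈ homog F (2 * m) (2 * m) :=
  mono_mem_homog (by simp)

theorem St_eq_span : St F m = Submodule.span F
    ({D | ∃ j : Fin (2 * m), D = fpd F (1 + mono F Finset.univ) j} ∪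
      {D | ∃ (u : Finset (Fin (2 * m))) (i j : Fin (2 * m)), 2 ≤ u.card ∧
        D = Dij F i j (mono F u)}) := by
  refine le_antisymm (iSup₂_le fun k hk => ?_) (Submodule.span_le.2 ?_)
  · rw [Stdeg]
    split_ifs with h
    · refine Submodule.span_mono ?_
      rintro _ ⟨j, rfl⟩
      exact Or.inl ⟨j, rfl⟩
    · refine Submodule.span_mono ?_
      rintro _ ⟨u, i, j, hu, rfl⟩
      have := hk.1
      exact Or.inr ⟨u, i, j, by omega, rfl⟩
  · rintro _ (⟨j, rfl⟩ | ⟨u, i, j, hu, rfl⟩)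
    · have hm : 1 ≤ m := by have := j.2; omega
      refine Submodule.mem_iSup_of_mem (-1) (Submodule.mem_iSup_of_mem ?_ ?_)
      · constructor <;> omega
      · rw [Stdeg, if_pos rfl]
        exact Submodule.subset_span ⟨j, rfl⟩
    · have h1 := u.card_le_univ
      rw [Fintype.card_fin] at h1
      refine Submodule.mem_iSup_of_mem (u.card - 2 : ℤ) (Submodule.mem_iSup_of_mem ?_ ?_)
      · constructor <;> omega
      · rw [Stdeg, if_neg (by omega)]
        exact Dij_mem_Sdeg (mono_mem_homog rfl) i j (by ring)

theorem fpd_mem_St (j : Fin (2 * m)) : fpd F (1 + mono F Finset.univ) j ∈ St F m := by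
  rw [St_eq_span]
  exact Submodule.subset_span (Or.inl ⟨j, rfl⟩)

theorem Dij_mem_St {k : ℕ} (hk : 2 ≤ k) {f : Grassmann F (2 * m)} (hf : f ∈ homog F (2 * m) k)
    (i j : Fin (2 * m)) : Dij F i j f ∈ St F m :=
  (homog_le (V := (St F m).comap (DijL i j)) fun u hu => by
    rw [Submodule.mem_comap, St_eq_span]
    exact Submodule.subset_span (Or.inr ⟨u, i, j, by omega, rfl⟩)) hf

theorem Sdeg_le_St {d : ℤ} (hd : 0 ≤ d) : Sdeg F (2 * m) d ≤ St F m :=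
  Submodule.span_le.2 (by
    rintro _ ⟨u, i, j, hu, rfl⟩
    exact Dij_mem_St (by omega) (mono_mem_homog rfl) i j)

/-- Elements of positive degree `k - 1` kill `T = ξ_1 ⋯ ξ_{2m}`, in the form needed for the
brackets. -/
theorem pd_mul_pd_top {k : ℕ} {f : Grassmann F (2 * m)} (hf : f ∈ homog F (2 * m) (k + 2))
    (i j : Fin (2 * m)) : parity F (2 * m) (pd F i f) * pd F j (mono F Finset.univ) =
      -(pd F j (pd F i f) * mono F Finset.univ) := by
  -- The product (∂_i f)T vanishes for degree reasons; differentiating this by ∂_j gives the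
  -- identity.
  have := congrArg (pd F j) (mul_eq_zero_of_mem_homog (pd_mem_homog hf i) top_mem_homog (by omega))
  rw [pd_mul, map_zero, add_comm] at this
  exact eq_neg_of_add_eq_zero_left this

theorem pd_top_mul_pd {k : ℕ} {f : Grassmann F (2 * m)} (hf : f ∈ homog F (2 * m) (k + 2))
    (i j : Fin (2 * m)) : pd F j (mono F Finset.univ) * pd F i f =
      -(mono F Finset.univ * pd F j (pd F i f)) := by
  have := congrArg (pd F j) (mul_eq_zero_of_mem_homog top_mem_homog (pd_mem_homog hf i) (by omega))
  rw [pd_mul, map_zero, parity_top] at this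
  exact eq_neg_of_add_eq_zero_left this

variable [CharZero F]

/-- T is even and T∂_kT = 0 by degree, so only the linear terms in T survive. This is how the top
component arises from L₋₁. -/
theorem bracket_fpd_top (i j : Fin (2 * m)) :
    superBracket (fpd F (1 + mono F Finset.univ) i) (fpd F (1 + mono F Finset.univ) j) =
      Dij F i j (mono F Finset.univ) := by
  have h : ∀ k : Fin (2 * m), mono F Finset.univ * pd F k (mono F Finset.univ) = 0 ∧
      pd F k (mono F Finset.univ) * mono F Finset.univ = 0 := by
    intro k
    have hk : pd F k (mono F Finset.univ) ∈ homog F (2 * m) (2 * m - 1) := by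
      refine pd_mem_homog ?_ k
      rw [Nat.sub_add_cancel (by have := k.2; omega)]
      exact top_mem_homog
    have h2 := k.2
    exact ⟨mul_eq_zero_of_mem_homog top_mem_homog hk (by omega),
      mul_eq_zero_of_mem_homog hk top_mem_homog (by omega)⟩
  rw [bracket_fpd_fpd, map_add (parity F (2 * m)), parity_one, parity_top, map_add, map_add,
    pd_one, pd_one, zero_add, zero_add, add_mul, one_mul, mul_add, mul_one, (h i).1, (h j).2,
    add_zero, add_zero, Dij]

/-- The remaining term is the value of D_ij(f) on T. It equals -T(∂_j∂_i f + ∂_i∂_j f), which is 0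
as the ∂'s anticommute. -/
theorem bracket_fpd_top_Dij {k : ℕ} {f : Grassmann F (2 * m)} (hf : f ∈ homog F (2 * m) (k + 2))
    (l i j : Fin (2 * m)) :
    superBracket (fpd F (1 + mono F Finset.univ) l) (Dij F i j f) =
      fpd F ((1 + mono F Finset.univ) * pd F l (pd F i f)) j +
        fpd F ((1 + mono F Finset.univ) * pd F l (pd F j f)) i := by
  have h : pd F j (mono F Finset.univ) * pd F i f + pd F i (mono F Finset.univ) * pd F j f = 0 := by
    rw [pd_top_mul_pd hf, pd_top_mul_pd hf, pd_pd j i]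
    simp
  have h' : fpd F (pd F j (mono F Finset.univ) * pd F i f) l +
      fpd F (pd F i (mono F Finset.univ) * pd F j f) l = 0 := by rw [← fpd_add, h, fpd_zero]
  rw [Dij, bracket_add, bracket_fpd_fpd, bracket_fpd_fpd, map_add (parity F (2 * m)), parity_one,
    parity_top, map_add, map_add, pd_one, pd_one, zero_add, zero_add, add_add_add_comm, h', add_zero]

theorem bracket_Dij_fpd_top {k : ℕ} {f : Grassmann F (2 * m)} (hf : f ∈ homog F (2 * m) (k + 2))
    (l i j : Fin (2 * m)) :
    superBracket (Dij F i j f) (fpd F (1 + mono F Finset.univ) l) =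
      fpd F (pd F l (parity F (2 * m) (pd F i f)) * (1 + mono F Finset.univ)) j +
        fpd F (pd F l (parity F (2 * m) (pd F j f)) * (1 + mono F Finset.univ)) i := by
  have h : parity F (2 * m) (pd F i f) * pd F j (mono F Finset.univ) +
      parity F (2 * m) (pd F j f) * pd F i (mono F Finset.univ) = 0 := by
    rw [pd_mul_pd_top hf, pd_mul_pd_top hf, pd_pd j i]
    simp
  have h1 : pd F i f * pd F j (mono F Finset.univ) +
      pd F j f * pd F i (mono F Finset.univ) = 0 := by
    rw [parity_of_mem_homog (pd_mem_homog hf i), parity_of_mem_homog (pd_mem_homog hf j),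
      smul_mul_assoc, smul_mul_assoc, ← smul_add] at h
    exact (smul_eq_zero.1 h).resolve_left (by simp)
  have h' : fpd F (pd F i f * pd F j (mono F Finset.univ)) l +
      fpd F (pd F j f * pd F i (mono F Finset.univ)) l = 0 := by rw [← fpd_add, h1, fpd_zero]
  rw [Dij, add_bracket, bracket_fpd_fpd, bracket_fpd_fpd, map_add, map_add,
    pd_one, pd_one, zero_add, zero_add, add_add_add_comm, h', zero_add]

theorem bracket_fpd_top_Dij_of_three_le {k : ℕ} {f : Grassmann F (2 * m)}
    (hf : f ∈ homog F (2 * m) (k + 3)) (l i j : Fin (2 * m)) :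
    superBracket (fpd F (1 + mono F Finset.univ) l) (Dij F i j f) = -Dij F i j (pd F l f) := by
  have h0 : ∀ i, mono F Finset.univ * pd F l (pd F i f) = 0 := fun i =>
    mul_eq_zero_of_mem_homog top_mem_homog (pd_mem_homog (pd_mem_homog hf i) l) (by omega)
  rw [bracket_fpd_top_Dij (k := k + 1) hf]
  simp only [add_mul, one_mul, h0, add_zero]
  rw [Dij, pd_pd l, pd_pd l, fpd_neg, fpd_neg, neg_add]

theorem bracket_Dij_fpd_top_of_three_le {k : ℕ} {f : Grassmann F (2 * m)}
    (hf : f ∈ homog F (2 * m) (k + 3)) (l i j : Fin (2 * m)) :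
    superBracket (Dij F i j f) (fpd F (1 + mono F Finset.univ) l) =
      Dij F i j (pd F l (parity F (2 * m) f)) := by
  have h0 : ∀ i, pd F l (parity F (2 * m) (pd F i f)) * mono F Finset.univ = 0 := fun i =>
    mul_eq_zero_of_mem_homog (pd_mem_homog (parity_mem_homog (pd_mem_homog hf i)) l)
      top_mem_homog (by omega)
  rw [bracket_Dij_fpd_top (k := k + 1) hf]
  simp only [mul_add, mul_one, h0, add_zero, Dij]
  rw [pd_pd i l, pd_pd j l, pd_parity i f, pd_parity j f, map_neg, map_neg, neg_neg, neg_neg]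

theorem bracketClosed_St : BracketClosed (St F m) := by
  have key : ∀ (u : Finset (Fin (2 * m))) (l i j : Fin (2 * m)), 2 ≤ u.card →
      superBracket (fpd F (1 + mono F Finset.univ) l) (Dij F i j (mono F u)) ∈ St F m ∧
      superBracket (Dij F i j (mono F u)) (fpd F (1 + mono F Finset.univ) l) ∈ St F m := by
    intro u l i j hu
    rcases Nat.lt_or_ge 2 u.card with h | h
    · obtain ⟨k, hk⟩ := Nat.exists_eq_add_of_le' (Nat.succ_le_of_lt h)
      have hf := mono_mem_homog (F := F) hk
      rw [bracket_fpd_top_Dij_of_three_le hf, bracket_Dij_fpd_top_of_three_le hf]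
      exact ⟨neg_mem (Dij_mem_St (by omega) (pd_mem_homog (k := k + 2) hf l) i j),
        Dij_mem_St (by omega) (pd_mem_homog (k := k + 2) (parity_mem_homog hf) l) i j⟩
    -- For |u| = 2 the second derivatives are scalars, so the factor 1+T persists and the bracket is
    -- a combination of the (1+T)∂_j.
    · have hf := mono_mem_homog (F := F) (k := 0 + 2) (le_antisymm h hu)
      have h1 : ∀ g ∈ homog F (2 * m) 0, ∀ j, fpd F ((1 + mono F Finset.univ) * g) j ∈ St F m ∧
          fpd F (g * (1 + mono F Finset.univ)) j ∈ St F m := by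
        intro g hg j
        obtain ⟨c, rfl⟩ := mem_algebraMap_of_homog_zero hg
        simp only [smul_mul_assoc, mul_smul_comm, one_mul, mul_one, fpd_smul]
        exact ⟨Submodule.smul_mem _ _ (fpd_mem_St j), Submodule.smul_mem _ _ (fpd_mem_St j)⟩
      rw [bracket_fpd_top_Dij hf, bracket_Dij_fpd_top hf]
      exact ⟨add_mem (h1 _ (pd_mem_homog (pd_mem_homog hf i) l) j).1
          (h1 _ (pd_mem_homog (pd_mem_homog hf j) l) i).1,
        add_mem (h1 _ (pd_mem_homog (parity_mem_homog (pd_mem_homog hf i)) l) j).2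
          (h1 _ (pd_mem_homog (parity_mem_homog (pd_mem_homog hf j)) l) i).2⟩
  have h := bracketClosed_span (F := F) (n := 2 * m)
    (s := {D | ∃ j : Fin (2 * m), D = fpd F (1 + mono F Finset.univ) j} ∪
      {D | ∃ (u : Finset (Fin (2 * m))) (i j : Fin (2 * m)), 2 ≤ u.card ∧
        D = Dij F i j (mono F u)}) (by
    rw [← St_eq_span]
    rintro _ (⟨l, rfl⟩ | ⟨u, i, j, hu, rfl⟩) _ (⟨l', rfl⟩ | ⟨v, i', j', hv, rfl⟩)
    · rw [bracket_fpd_top]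
      exact Dij_mem_St (by have := l.2; omega) top_mem_homog _ _
    · exact (key v l i' j' hv).1
    · exact (key u l' i j hu).2
    · obtain ⟨k, hk⟩ := Nat.exists_eq_add_of_le' hu
      obtain ⟨k', hk'⟩ := Nat.exists_eq_add_of_le' hv
      have hm : ∀ p q r s, Dij F r s (parity F (2 * m) (pd F p (mono F u)) *
          pd F q (mono F v)) ∈ St F m := fun p q r s =>
        Dij_mem_St (by omega) (mul_mem_homog
          (parity_mem_homog (pd_mem_homog (k := k + 1) (mono_mem_homog hk) p))
          (pd_mem_homog (k := k' + 1) (mono_mem_homog hk') q)) r s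
      rw [bracket_Dij_Dij]
      exact add_mem (add_mem (add_mem (hm _ _ _ _) (hm _ _ _ _)) (hm _ _ _ _)) (hm _ _ _ _))
  rwa [← St_eq_span] at h

theorem hasCartanGenerators_St (hm : 2 ≤ m) : HasCartanGenerators 1 (St F m) (Stdeg F m (-1))
    (Stdeg F m 0) (Stdeg F m 1) (cartanS F (2 * m)) := by
  classical
  obtain ⟨a, ha⟩ : ∃ a : Fin (2 * m), a.val = 0 := ⟨⟨0, by omega⟩, rfl⟩
  obtain ⟨a₁, ha₁⟩ : ∃ a : Fin (2 * m), a.val = 1 := ⟨⟨1, by omega⟩, rfl⟩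
  obtain ⟨a₂, ha₂⟩ : ∃ a : Fin (2 * m), a.val = 2 := ⟨⟨2, by omega⟩, rfl⟩
  obtain ⟨a₃, ha₃⟩ : ∃ a : Fin (2 * m), a.val = 3 := ⟨⟨3, by omega⟩, rfl⟩
  have h12 : a₁ ≠ a₂ := fun h => by simp [h, ha₂] at ha₁
  have h13 : a₁ ≠ a₃ := fun h => by simp [h, ha₃] at ha₁
  have h23 : a₂ ≠ a₃ := fun h => by simp [h, ha₃] at ha₂
  have hs : sepField F (2 * m) ∈ cartanS F (2 * m) := sepField_mem_cartanS (by omega)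
  have hS0 : Stdeg F m 0 = Sdeg F (2 * m) 0 := if_neg (by omega)
  have hS1 : Stdeg F m 1 = Sdeg F (2 * m) 1 := if_neg (by omega)
  rw [hS0, hS1]
  have hxw : IsWeightVector (cartanS F (2 * m)) (Stdeg F m (-1)) (0 - coordOn (cartanS F (2 * m)) a₁)
      (fpd F (1 + mono F Finset.univ) a₁) := by
    refine ⟨?_, fpd_ne_zero (fun h => ?_) _, fun h => ?_⟩
    · rw [Stdeg, if_pos rfl]
      exact Submodule.subset_span ⟨a₁, rfl⟩
    -- Multiply 1 + T = 0 by T and use T² = 0.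
    · have h' := congrArg (fun x => mono F Finset.univ * x) h
      have h0 : mono F Finset.univ * mono F Finset.univ = (0 : Grassmann F (2 * m)) :=
        mul_eq_zero_of_mem_homog top_mem_homog top_mem_homog (by omega)
      simp only [mul_add, mul_one, h0, add_zero, mul_zero] at h'
      exact mono_ne_zero _ h'
    · refine bracket_fpd_of_eigenvector cartanS_le_cartanW h ?_ _
      -- The Cartan subalgebra is traceless, so T has weight 0 like 1, and (1+T)∂_j is a weight
      -- vector although not homogeneous in degree.
      rw [map_add, diag_mono, sum_coordOn_cartanS, ← mono_empty, diag_mono]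
      simp
  refine hasCartanGenerators_of (starWt _ a) (starVec F a) _ (fpd F (1 + mono F Finset.univ) a₁) _
    (fun _ => fpd F (mono F {a₁, a₂}) a₃) ∅ hxw
    (fun _ => isWeightVector_fpd_mono cartanS_le_cartanW (fpd_mem_Sdeg ?_ ?_))
    (bracket_starVec cartanS_le_cartanW) ?_ ⟨sepField F (2 * m), hs⟩ (starVal a) (-1) (fun _ => 0)
    (starWt_sepField ha hs) ?_ ?_ (starVal_injective (by omega))
    (fun _ _ _ => Subsingleton.elim _ _)
    (by simp) (fun k => by have := lt_abs_starVal (by omega) ha k; omega)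
    (fun k _ => by have := lt_abs_starVal (by omega) ha k; omega) bracketClosed_Sdeg_zero
    bracketClosed_St cartanS_le_Sdeg (Sdeg_le_St le_rfl) ?_ (Sdeg_le_St (by omega)) ?_ ?_
  · simp [h13.symm, h23.symm]
  · simp [Finset.card_pair h12]
  · rintro (⟨j, hj⟩ | ⟨j, hj⟩)
    · exact fpd_mem_Sdeg (by simpa using hj) rfl
    · exact fpd_mem_Sdeg (by simpa using hj.symm) rfl
  · simp [coordOn_apply, coord_sepField, sepDiag, ha₁]
  · intro _
    -- The value of the weight of ξ_{a₁}ξ_{a₂}∂_{a₃} is 1 + 2 - 3 = 0.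
    simp [coordOn_apply, coord_sepField, Finset.sum_pair h12, sepDiag, ha₁, ha₂, ha₃]
    norm_num
  · rw [Stdeg, if_pos rfl]
    refine Submodule.span_le.2 ?_
    rintro _ ⟨j, rfl⟩
    exact fpd_mem_St j
  · intro h _ N hN _ hstar
    exact Sdeg_zero_le_of_star hN (fun j hj => by simpa [starVec] using hstar (Sum.inl ⟨j, hj⟩))
      (fun j hj => by simpa [starVec] using hstar (Sum.inr ⟨j, hj⟩))
  · intro N hN h0 hx hy
    have h2 : ∀ j, fpd F (1 + mono F Finset.univ) j ∈ N := fun j => by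
      by_cases hj : a₁ = j
      · exact hj ▸ hx
      · refine fpd_mem_transfer hN (h0 (fpd_xi_mem_Sdeg hj)) hx ?_
        rw [map_add, pd_one, zero_add, xi_mul_pd_mono_of_mem hj (Finset.mem_univ _)]
    rw [St_eq_span]
    refine Submodule.span_le.2 ?_
    rintro _ (⟨j, rfl⟩ | ⟨u, i, j, hu, rfl⟩)
    · exact h2 j
    refine Dij_mono_mem_of_univ (d := 2) (fun l i j u hu h => ?_) (fun i j => ?_) u hu i j
    · have := hN _ (h2 l) _ h
      obtain ⟨k, hk⟩ := Nat.exists_eq_add_of_le' (Nat.succ_le_of_lt hu)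
      rw [bracket_fpd_top_Dij_of_three_le (mono_mem_homog hk)] at this
      exact neg_mem_iff.1 this
    · rw [← bracket_fpd_top]
      exact hN _ (h2 i) _ (h2 j)

end TypeStilde

/-! ### The index involution. -/

section Prime

variable {n : ℕ}

theorem prime_val (i : Fin n) : (prime i).val =
    if i.val < n / 2 then i.val + n / 2 else if i.val < 2 * (n / 2) then i.val - n / 2 else i.val := by
  unfold prime
  split_ifs <;> rfl

theorem prime_prime (i : Fin n) : prime (prime i) = i := by
  have := i.2
  ext
  rw [prime_val, prime_val]
  split_ifs <;> omega

theorem prime_injective : Function.Injective (prime (n := n)) :=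
  Function.LeftInverse.injective prime_prime

theorem prime_eq_iff {i j : Fin n} : prime i = j ↔ i = prime j :=
  ⟨fun h => by rw [← h, prime_prime], fun h => by rw [h, prime_prime]⟩

theorem sum_prime {M : Type*} [AddCommMonoid M] (f : Fin n → M) :
    ∑ i, f (prime i) = ∑ i, f i :=
  Equiv.sum_comp (Function.Involutive.toPerm prime prime_prime) f

end Prime

/-! ### The Poisson bracket and the Hamiltonian algebra H(n). -/

section Poisson

variable {F : Type*} [Field F] {n : ℕ}

theorem end_neg_smul (a : F) (A : Module.End F (Grassmann F n)) : -a • A = -(a • A) :=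
  neg_smul a A

/-- The Hamiltonian vector field of an element of `Λ(n)`, without the sign in `DH`. -/
def ham : Grassmann F n →ₗ[F] Module.End F (Grassmann F n) :=
  ∑ i, fpdL (prime i) ∘ₗ pd F i

theorem ham_apply (f : Grassmann F n) : ham f = ∑ i, fpd F (pd F i f) (prime i) := by
  rw [ham, LinearMap.sum_apply]
  rfl

theorem DH_eq (u : Finset (Fin n)) : DH F u = (-1 : F) ^ u.card • ham (mono F u) := by
  rw [ham_apply]
  rfl

theorem ham_one : ham (1 : Grassmann F n) = 0 := by simp [ham_apply]

theorem ham_mono_ne_zero {u : Finset (Fin n)} (hu : u.Nonempty) : ham (mono F u) ≠ 0 := by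
  obtain ⟨k, hk⟩ := hu
  intro h
  have h1 := LinearMap.congr_fun h (xi F (prime k))
  rw [ham_apply, LinearMap.sum_apply, Finset.sum_eq_single k] at h1
  · rcases pd_mono_of_mem (F := F) hk with h2 | h2 <;>
      simp [fpd_apply, h2, mono_ne_zero] at h1
  · intro i _ hi
    simp [fpd_apply, prime_injective.ne hi]
  · simp

/-- The Poisson bracket on `Λ(n)`. -/
def poisson (f g : Grassmann F n) : Grassmann F n :=
  ∑ i, pd F i (parity F n f) * pd F (prime i) g

/-- By the Leibniz rule the field of {f, g} splits into two double sums. One is the first half of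
the bracket of fields; the other becomes the second half after exchanging the summations and
reindexing by the involution. -/
theorem bracket_ham_ham [CharZero F] (f g : Grassmann F n) :
    superBracket (ham f) (ham g) = ham (poisson f g) := by
  have h1 : ∀ i j, fpd F (pd F j (pd F i (parity F n f) * pd F (prime i) g)) (prime j) =
      fpd F (pd F i f * pd F (prime i) (pd F j g)) (prime j) +
        fpd F (pd F j (pd F i (parity F n f)) * pd F (prime i) g) (prime j) := by
    intro i j
    rw [pd_mul, pd_pd j (prime i), pd_parity i f, map_neg (parity F n), parity_parity, neg_mul_neg,
      fpd_add, add_comm]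
  have h2 : ∑ i, ∑ j, fpd F (pd F (prime j) (parity F n (pd F i f)) * pd F j g) (prime i) =
      ∑ i, ∑ j, fpd F (pd F j (pd F i (parity F n f)) * pd F (prime i) g) (prime j) := by
    rw [Finset.sum_comm (s := Finset.univ) (t := Finset.univ)
      (f := fun i j => fpd F (pd F j (pd F i (parity F n f)) * pd F (prime i) g) (prime j))]
    refine Finset.sum_congr rfl fun i _ => ?_
    rw [← sum_prime]
    refine Finset.sum_congr rfl fun j _ => ?_
    rw [prime_prime, pd_pd i j, pd_parity i f, map_neg]
    simp
  rw [poisson, map_sum, ham_apply, ham_apply, sum_bracket]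
  simp only [bracket_sum, bracket_fpd_fpd, Finset.sum_add_distrib, ham_apply, h1, h2]

variable (F n) in
/-- The span of the monomials other than `ξ_1 ⋯ ξ_n`. -/
def topFree : Submodule F (Grassmann F n) :=
  Submodule.span F {a | ∃ u : Finset (Fin n), u ≠ Finset.univ ∧ a = mono F u}

theorem pd_mem_topFree (i : Fin n) (f : Grassmann F n) : pd F i f ∈ topFree F n := by
  have : ⊤ ≤ (topFree F n).comap (pd F i) := by
    rw [← span_mono, Submodule.span_le]
    rintro _ ⟨u, rfl⟩
    rw [SetLike.mem_coe, Submodule.mem_comap]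
    by_cases hi : i ∈ u
    · have hm : mono F (u.erase i) ∈ topFree F n :=
        Submodule.subset_span ⟨u.erase i, fun h => Finset.notMem_erase i u (by simp [h]), rfl⟩
      rcases pd_mono_of_mem (F := F) hi with h | h <;> rw [h]
      · exact hm
      · exact neg_mem hm
    · rw [pd_mono_of_notMem hi]
      exact zero_mem _
  exact this Submodule.mem_top

/-- ∑ ∂_i∂_{i'} g changes sign under the involution, hence is 0. So {f, g} is a sum of derivatives
∂_i(…), and no derivative involves the top monomial. -/
theorem poisson_mem_topFree [CharZero F] (f g : Grassmann F n) : poisson f g ∈ topFree F n := by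
  have h0 : ∑ i, pd F i (pd F (prime i) g) = 0 := by
    have h1 : ∑ i, pd F i (pd F (prime i) g) = -∑ i, pd F i (pd F (prime i) g) := by
      conv_lhs => rw [← sum_prime]
      rw [← Finset.sum_neg_distrib]
      refine Finset.sum_congr rfl fun i _ => ?_
      rw [prime_prime, pd_pd]
    have h2 : (2 : F) • ∑ i, pd F i (pd F (prime i) g) = 0 := by
      rw [two_smul]
      nth_rewrite 1 [h1]
      simp
    simpa using h2
  have h1 : poisson f g = ∑ i, pd F i (parity F n f * pd F (prime i) g) := by
    simp only [pd_mul, parity_parity, Finset.sum_add_distrib, ← Finset.mul_sum, h0, mul_zero,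
      add_zero, poisson]
  rw [h1]
  exact Submodule.sum_mem _ fun i _ => pd_mem_topFree _ _

theorem poisson_mem_homog {k l : ℕ} {f g : Grassmann F n} (hf : f ∈ homog F n (k + 1))
    (hg : g ∈ homog F n (l + 1)) : poisson f g ∈ homog F n (k + l) :=
  Submodule.sum_mem _ fun i _ =>
    mul_mem_homog (pd_mem_homog (parity_mem_homog hf) i) (pd_mem_homog hg _)

/-- A subspace of `Λ(n)` closed under the Poisson bracket. -/
def PoissonClosed (V : Submodule F (Grassmann F n)) : Prop :=
  ∀ f ∈ V, ∀ g ∈ V, poisson f g ∈ V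

theorem PoissonClosed.map [CharZero F] {V : Submodule F (Grassmann F n)} (hV : PoissonClosed V) :
    BracketClosed (V.map ham) := by
  rintro _ ⟨f, hf, rfl⟩ _ ⟨g, hg, rfl⟩
  rw [bracket_ham_ham]
  exact Submodule.mem_map_of_mem (hV f hf g hg)

theorem BracketClosed.comap [CharZero F] {N : Submodule F (Module.End F (Grassmann F n))}
    (hN : BracketClosed N) : PoissonClosed (N.comap ham) := by
  intro f hf g hg
  rw [Submodule.mem_comap, ← bracket_ham_ham]
  exact hN _ hf _ hg

theorem DH_mem_iff {N : Submodule F (Module.End F (Grassmann F n))} {u : Finset (Fin n)} :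
    DH F u ∈ N ↔ ham (mono F u) ∈ N := by
  rw [DH_eq]
  exact Submodule.smul_mem_iff _ (by simp)

theorem Hdeg_eq_map {d : ℤ} {k : ℕ} (hd : (k : ℤ) = d + 2) :
    Hdeg F n d = (homog F n k).map ham := by
  refine le_antisymm (Submodule.span_le.2 ?_) (Submodule.map_le_iff_le_comap.2 (homog_le ?_))
  · rintro _ ⟨u, hu, rfl⟩
    exact DH_mem_iff.2 (Submodule.mem_map_of_mem (mono_mem_homog (by omega)))
  · intro u hu
    have h : DH F u ∈ Hdeg F n d := Submodule.subset_span ⟨u, by omega, rfl⟩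
    exact DH_mem_iff.1 h

/-- Degrees -1 to n - 3 correspond to monomials of size 1 to n - 1; the empty monomial may be added
because constants have zero Hamiltonian field. -/
theorem H_eq_map : H F n = (topFree F n).map ham := by
  refine le_antisymm (iSup₂_le fun k hk => Submodule.span_le.2 ?_)
    (Submodule.map_le_iff_le_comap.2 (Submodule.span_le.2 ?_))
  · rintro _ ⟨u, hu, rfl⟩
    refine DH_mem_iff.2 (Submodule.mem_map_of_mem (Submodule.subset_span ⟨u, ?_, rfl⟩))
    rintro rfl
    have := hk.2
    rw [Finset.card_univ, Fintype.card_fin] at hu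
    omega
  · rintro _ ⟨u, hu, rfl⟩
    rw [SetLike.mem_coe, Submodule.mem_comap]
    rcases u.eq_empty_or_nonempty with rfl | hne
    · rw [mono_empty, ham_one]
      exact zero_mem _
    · have h1 := hne.card_pos
      have h2 := (Finset.card_lt_iff_ne_univ u).2 hu
      rw [Fintype.card_fin] at h2
      refine Submodule.mem_iSup_of_mem (u.card - 2 : ℤ) (Submodule.mem_iSup_of_mem ?_
        (DH_mem_iff.1 (Submodule.subset_span ⟨u, by ring, rfl⟩)))
      constructor <;> omega

theorem bracketClosed_H [CharZero F] : BracketClosed (H F n) := by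
  rw [H_eq_map]
  exact PoissonClosed.map fun f _ g _ => poisson_mem_topFree f g

theorem bracketClosed_Hdeg_zero [CharZero F] : BracketClosed (Hdeg F n 0) := by
  rw [Hdeg_eq_map (k := 2) rfl]
  exact PoissonClosed.map fun f hf g hg => poisson_mem_homog (k := 1) (l := 1) hf hg

theorem Hdeg_le_H {d : ℤ} (h1 : -1 ≤ d) (h2 : d ≤ n - 3) : Hdeg F n d ≤ H F n :=
  le_iSup₂_of_le d ⟨h1, h2⟩ le_rfl

theorem ham_mono_mem_Hdeg {u : Finset (Fin n)} {d : ℤ} (hd : (u.card : ℤ) = d + 2) :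
    ham (mono F u) ∈ Hdeg F n d :=
  DH_mem_iff.1 (Submodule.subset_span ⟨u, hd, rfl⟩)

theorem cartanH_le_cartanW : cartanH F n ≤ cartanW F n :=
  Submodule.span_le.2 (by
    rintro _ ⟨i, -, rfl⟩
    exact sub_mem (Submodule.subset_span ⟨i, rfl⟩) (Submodule.subset_span ⟨prime i, rfl⟩))

theorem cartanH_le_Hdeg : cartanH F n ≤ Hdeg F n 0 := by
  refine Submodule.span_le.2 ?_
  rintro _ ⟨i, hi, rfl⟩
  have hne : prime i ≠ i := fun h => by
    have := congrArg Fin.val h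
    rw [prime_val, if_pos hi] at this
    omega
  have h1 : ham (xi F (prime i) * xi F i) ∈ Hdeg F n 0 := by
    rw [Hdeg_eq_map (k := 1 + 1) rfl]
    exact Submodule.mem_map_of_mem (mul_mem_homog (xi_mem_homog _) (xi_mem_homog _))
  have h2 : ham (xi F (prime i) * xi F i) =
      fpd F (xi F i) i - fpd F (xi F (prime i)) (prime i) := by
    rw [ham_apply]
    simp only [pd_xi_mul, pd_xi, fpd_sub, Finset.sum_sub_distrib]
    congr 1
    · rw [Finset.sum_eq_single (prime i)]
      · simp [prime_prime]
      · intro j _ hj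
        simp [hj]
      · simp
    · rw [Finset.sum_eq_single i]
      · simp
      · intro j _ hj
        simp [hj]
      · simp
  rwa [← h2]

theorem fpd_sub_mem_cartanH (i : Fin n) :
    fpd F (xi F i) i - fpd F (xi F (prime i)) (prime i) ∈ cartanH F n := by
  by_cases h1 : i.val < n / 2
  · exact Submodule.subset_span ⟨i, h1, rfl⟩
  · by_cases h2 : i.val < 2 * (n / 2)
    · rw [← neg_sub]
      refine neg_mem (Submodule.subset_span ⟨prime i, ?_, by rw [prime_prime]⟩)
      rw [prime_val, if_neg h1, if_pos h2]
      omega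
    · have : prime i = i := Fin.ext (by rw [prime_val, if_neg h1, if_neg h2])
      rw [this, sub_self]
      exact zero_mem _

theorem diag_mem_cartanH [CharZero F] {c : Fin n → F} (hc : ∀ i, c (prime i) = -c i) :
    diag c ∈ cartanH F n := by
  have h : (2 : F) • diag c =
      ∑ i, c i • (fpd F (xi F i) i - fpd F (xi F (prime i)) (prime i)) := by
    have h1 : ∑ i, c i • fpd F (xi F (prime i)) (prime i) = -diag c := by
      rw [← sum_prime, diag, ← Finset.sum_neg_distrib]
      exact Finset.sum_congr rfl fun i _ => by rw [prime_prime, hc, end_neg_smul]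
    simp only [smul_sub, Finset.sum_sub_distrib, h1, two_smul, sub_neg_eq_add]
    rfl
  rw [← Submodule.smul_mem_iff _ (two_ne_zero (α := F)), h]
  exact Submodule.sum_mem _ fun i _ => Submodule.smul_mem _ _ (fpd_sub_mem_cartanH i)

theorem coordOn_prime (i : Fin n) (h : cartanH F n) :
    coordOn (cartanH F n) (prime i) h = -coordOn (cartanH F n) i h := by
  have : cartanH F n ≤ LinearMap.ker (coord (F := F) (prime i) + coord i) := by
    refine Submodule.span_le.2 ?_
    rintro _ ⟨k, -, rfl⟩
    rw [SetLike.mem_coe, LinearMap.mem_ker, LinearMap.add_apply, map_sub, map_sub, coord_fpd_xi,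
      coord_fpd_xi, coord_fpd_xi, coord_fpd_xi]
    simp only [prime_eq_iff, prime_prime]
    ring
  exact eq_neg_of_add_eq_zero_left (this h.2)

variable [CharZero F]

omit [CharZero F] in
theorem pd_diag (c : Fin n → F) (k : Fin n) (g : Grassmann F n) :
    diag c (pd F k g) = pd F k (diag c g) - c k • pd F k g := by
  simp only [diag, LinearMap.sum_apply, LinearMap.smul_apply, fpd_apply, map_sum, map_smul,
    pd_xi_mul, smul_sub, Finset.sum_sub_distrib, smul_ite, smul_zero, Finset.sum_ite_eq,
    Finset.mem_univ, if_true, pd_pd k, mul_neg, smul_neg, Finset.sum_neg_distrib]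
  abel

/-- The antisymmetry of c makes the shift from commuting past ∂_k cancel the one from the factor
∂_{k'}, so the weight of the field is that of g. -/
theorem bracket_diag_ham {c : Fin n → F} (hc : ∀ i, c (prime i) = -c i) (g : Grassmann F n) :
    superBracket (diag c) (ham g) = ham (diag c g) := by
  rw [ham_apply, ham_apply, bracket_sum]
  refine Finset.sum_congr rfl fun k _ => ?_
  rw [bracket_diag_fpd, pd_diag, hc, fpd_sub, fpd_smul, end_neg_smul]
  abel

theorem bracket_ham_mono (h : cartanH F n) (u : Finset (Fin n)) :
    superBracket (h : Module.End F (Grassmann F n)) (ham (mono F u)) =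
      (∑ i ∈ u, coordOn (cartanH F n) i) h • ham (mono F u) := by
  conv_lhs => rw [← diag_coordOn cartanH_le_cartanW h]
  rw [bracket_diag_ham (fun i => coordOn_prime i h), diag_mono, map_smul, LinearMap.sum_apply]

theorem isWeightVector_ham_mono {u : Finset (Fin n)} {d : ℤ} (hd : (u.card : ℤ) = d + 2)
    (h1 : -1 ≤ d) :
    IsWeightVector (cartanH F n) (Hdeg F n d) (∑ i ∈ u, coordOn (cartanH F n) i)
      (ham (mono F u)) :=
  ⟨ham_mono_mem_Hdeg hd, ham_mono_ne_zero (Finset.card_pos.1 (by omega)),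
    fun h => bracket_ham_mono h u⟩

/-- The diagonal entries of an element of the Cartan subalgebra that separates the weights used
for `H`. -/
def hamDiag (i : Fin n) : ℤ :=
  if i.val < n / 2 then (if i.val = 0 then 10 * n else n + i.val)
  else if i.val < 2 * (n / 2) then
    (if i.val = n / 2 then -(10 * n) else -(n + (i.val - n / 2)))
  else 0

theorem hamDiag_prime (i : Fin n) : hamDiag (prime i) = -hamDiag i := by
  have := i.2
  simp only [hamDiag, prime_val]
  split_ifs <;> omega

variable (F n) in
/-- The diagonal vector field with entries `hamDiag`. -/
def hamField : Module.End F (Grassmann F n) := diag fun i => (hamDiag i : F)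

theorem hamField_mem : hamField F n ∈ cartanH F n :=
  diag_mem_cartanH fun i => by rw [hamDiag_prime]; push_cast; rfl

theorem sum_coordOn_hamField (u : Finset (Fin n)) :
    (∑ i ∈ u, coordOn (cartanH F n) i) ⟨hamField F n, hamField_mem⟩ =
      ((∑ i ∈ u, hamDiag i : ℤ) : F) := by
  rw [LinearMap.sum_apply]
  push_cast
  exact Finset.sum_congr rfl fun i _ => coord_diag _ _

end Poisson

/-! ### Generation in the Poisson algebra. -/

section Generation

variable {F : Type*} [Field F] {n : ℕ}

theorem xi_mul_xi_mul_xi_rotate (a b c : Fin n) :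
    xi F a * (xi F b * xi F c) = xi F b * (xi F c * xi F a) := by
  rw [← mul_assoc, xi_mul_xi a b, neg_mul, mul_assoc, xi_mul_xi a c, mul_neg, neg_neg]

theorem xi_mul_xi_mul_xi_swap (a b c : Fin n) :
    xi F a * (xi F b * xi F c) = -(xi F b * (xi F a * xi F c)) := by
  rw [← mul_assoc, xi_mul_xi a b, neg_mul, mul_assoc]

theorem mono_mem_of_triple_mem {V : Submodule F (Grassmann F n)} {a b c : Fin n} (hab : a ≠ b)
    (hac : a ≠ c) (hbc : b ≠ c) (h : xi F a * (xi F b * xi F c) ∈ V) :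
    mono F {a, b, c} ∈ V :=
  mono_mem_of_prodXi_mem (l := [a, b, c]) (by simp [hab, hac, hbc]) (by simp)
    (by simpa [prodXi] using h)

theorem triple_mem_of_mono_mem {V : Submodule F (Grassmann F n)} {a b c : Fin n}
    (h : mono F {a, b, c} ∈ V) : xi F a * (xi F b * xi F c) ∈ V := by
  have := prodXi_mem_of_mono_mem (V := V) (l := [a, b, c]) fun _ => by simpa using h
  simpa [prodXi] using this

theorem pair_mem_of_mono_mem {V : Submodule F (Grassmann F n)} {a b : Fin n}
    (h : mono F {a, b} ∈ V) : xi F a * xi F b ∈ V := by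
  have := prodXi_mem_of_mono_mem (V := V) (l := [a, b]) fun _ => by simpa using h
  simpa [prodXi] using this

theorem homog_three_le {V : Submodule F (Grassmann F n)}
    (h : ∀ a b c, a ≠ b → a ≠ c → b ≠ c → xi F a * (xi F b * xi F c) ∈ V) :
    homog F n 3 ≤ V :=
  homog_le fun u hu => by
    obtain ⟨a, b, c, hab, hac, hbc, rfl⟩ := Finset.card_eq_three.1 hu
    exact mono_mem_of_triple_mem hab hac hbc (h a b c hab hac hbc)

theorem homog_two_le {V : Submodule F (Grassmann F n)}
    (h : ∀ a b, a ≠ b → xi F a * xi F b ∈ V) : homog F n 2 ≤ V :=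
  homog_le fun _ hu => mono_mem_of_xi_mul_xi_mem h hu

theorem homog_one_le {V : Submodule F (Grassmann F n)} (h : ∀ a, xi F a ∈ V) :
    homog F n 1 ≤ V :=
  homog_le fun u hu => by
    obtain ⟨a, rfl⟩ := Finset.card_eq_one.1 hu
    simpa using h a

/-- The Poisson bracket with a quadratic monomial. -/
theorem poisson_pair (p q : Fin n) (g : Grassmann F n) :
    poisson (xi F p * xi F q) g =
      xi F q * pd F (prime p) g - xi F p * pd F (prime q) g := by
  simp only [poisson, parity_mul, parity_xi, neg_mul_neg, pd_xi_mul, pd_xi, sub_mul, ite_mul,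
    zero_mul, mul_ite, mul_one, mul_zero, Finset.sum_sub_distrib, Finset.sum_ite_eq',
    Finset.mem_univ, if_true]

/-- The Poisson bracket with a cubic monomial. -/
theorem poisson_triple (a b c : Fin n) (g : Grassmann F n) :
    poisson (xi F a * (xi F b * xi F c)) g =
      -(xi F b * xi F c * pd F (prime a) g) + xi F a * xi F c * pd F (prime b) g -
        xi F a * xi F b * pd F (prime c) g := by
  have h : ∀ i, pd F i (parity F n (xi F a * (xi F b * xi F c))) * pd F (prime i) g =
      -(if i = a then xi F b * xi F c * pd F (prime i) g else 0) +
        (if i = b then xi F a * xi F c * pd F (prime i) g else 0) -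
        (if i = c then xi F a * xi F b * pd F (prime i) g else 0) := by
    intro i
    simp only [parity_mul, parity_xi, neg_mul, map_neg, pd_xi_mul, pd_xi]
    split_ifs <;> noncomm_ring
  simp only [poisson, h, Finset.sum_add_distrib, Finset.sum_sub_distrib, Finset.sum_neg_distrib,
    Finset.sum_ite_eq', Finset.mem_univ, if_true]

/-- Let v be u without a and b. In {ξ_aξ_bξ_{e'}, ξ_e x^v} the contraction of e' with e gives ±x^u,
and the hypotheses kill the contractions at a and b. The degree rises from k to k + 1. -/
theorem mono_mem_of_cubic {V : Submodule F (Grassmann F n)} (hV : PoissonClosed V)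
    (h3 : homog F n 3 ≤ V) {k : ℕ} (hk : homog F n k ≤ V) {u : Finset (Fin n)}
    (hu : u.card = k + 1) {a b e : Fin n} (ha : a ∈ u) (hb : b ∈ u) (hab : a ≠ b) (he : e ∉ u)
    (hae : prime a ≠ e) (hbe : prime b ≠ e)
    (h1 : xi F (prime e) * (xi F e * pd F (prime a) (mono F ((u.erase a).erase b))) = 0)
    (h2 : xi F (prime e) * (xi F e * pd F (prime b) (mono F ((u.erase a).erase b))) = 0) :
    mono F u ∈ V := by
  set v := (u.erase a).erase b with hv
  have hb' : b ∈ u.erase a := Finset.mem_erase.2 ⟨hab.symm, hb⟩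
  have hvc : v.card + 1 = k := by
    rw [hv, Finset.card_erase_of_mem hb', Finset.card_erase_of_mem ha, hu]
    have : 1 < u.card := Finset.one_lt_card.2 ⟨a, ha, b, hb, hab⟩
    omega
  have hev : e ∉ v := fun h => he (Finset.mem_of_mem_erase (Finset.mem_of_mem_erase h))
  have hf : xi F a * (xi F b * xi F (prime e)) ∈ homog F n 3 := by
    have := prodXi_mem_homog (F := F) [a, b, prime e]
    simpa [prodXi] using this
  have hg : xi F e * mono F v ∈ homog F n k := by
    have := mul_mem_homog (xi_mem_homog (F := F) e) (mono_mem_homog (F := F) (u := v) rfl)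
    rwa [add_comm, hvc] at this
  have key := hV _ (h3 hf) _ (hk hg)
  rw [poisson_triple, prime_prime, pd_xi_mul, pd_xi_mul, pd_xi_mul, if_neg hae, if_neg hbe,
    if_pos rfl, pd_mono_of_notMem hev, zero_sub, zero_sub, mul_zero, sub_zero, mul_neg, mul_neg,
    mul_assoc, mul_assoc, h1, h2, mul_zero, mul_zero, neg_zero, neg_zero, add_zero, zero_sub,
    neg_mem_iff, mul_assoc] at key
  rcases mono_eq_xi_mul (F := F) ha with h | h <;> rcases mono_eq_xi_mul (F := F) hb' with h' | h'
    <;> rw [h, h'] <;> simpa using key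

theorem homog_succ_le {V : Submodule F (Grassmann F n)} (hV : PoissonClosed V)
    (h3 : homog F n 3 ≤ V) {k : ℕ} (hk : homog F n k ≤ V) (hk3 : 3 ≤ k) (hkn : k + 1 < n) :
    homog F n (k + 1) ≤ V := by
  refine homog_le fun u hu => ?_
  -- In the first case a and b are chosen in u away from e'. The unwanted terms then contain ξ_{e'}
  -- twice, or ξ_e twice if e' = e.
  by_cases hex : ∃ e, e ∉ u ∧ (prime e ∈ u ∨ prime e = e)
  · obtain ⟨e, he, he'⟩ := hex
    have hc : 1 < (u.erase (prime e)).card := by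
      have := Finset.pred_card_le_card_erase (s := u) (a := prime e)
      omega
    obtain ⟨a, ha, b, hb, hab⟩ := Finset.one_lt_card.1 hc
    rw [Finset.mem_erase] at ha hb
    have hz : ∀ c, c ∈ u → xi F (prime e) *
        (xi F e * pd F (prime c) (mono F ((u.erase a).erase b))) = 0 := by
      intro c hc
      rcases he' with he' | he'
      · rw [← mul_assoc, xi_mul_xi, neg_mul, mul_assoc, xi_mul_pd_mono_of_mem, mul_zero, neg_zero]
        · exact prime_injective.ne fun h => he (h ▸ hc)
        · exact Finset.mem_erase.2 ⟨hb.1.symm, Finset.mem_erase.2 ⟨ha.1.symm, he'⟩⟩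
      · rw [he', ← mul_assoc, xi_mul_self, zero_mul]
    exact mono_mem_of_cubic hV h3 hk hu ha.2 hb.2 hab he (fun h => ha.1 (prime_eq_iff.1 h))
      (fun h => hb.1 (prime_eq_iff.1 h)) (hz a ha.2) (hz b hb.2)
  · push Not at hex
    obtain ⟨e, he⟩ : ∃ e, e ∉ u := by
      by_contra h
      push Not at h
      rw [Finset.eq_univ_of_forall h, Finset.card_univ, Fintype.card_fin] at hu
      omega
    -- Now u is stable under the involution. It has more than one element and at most one index is
    -- fixed, so it contains a pair a ≠ a'. With b = a' the unwanted derivatives are in erased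
    -- variables and vanish.
    obtain ⟨a, ha, ha'⟩ : ∃ a ∈ u, prime a ≠ a := by
      by_contra h
      push Not at h
      obtain ⟨a, ha, b, hb, hab⟩ := Finset.one_lt_card.1 (show 1 < u.card by omega)
      have h1 := congrArg Fin.val (h a ha)
      have h2 := congrArg Fin.val (h b hb)
      have := a.2
      have := b.2
      rw [prime_val] at h1 h2
      refine hab (Fin.ext ?_)
      split_ifs at h1 h2 <;> omega
    have hau : prime a ∈ u := by
      by_contra h
      exact (hex _ h).1 (by rwa [prime_prime])
    refine mono_mem_of_cubic hV h3 hk hu ha hau (Ne.symm ha') he (fun h => he (h ▸ hau))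
      (fun h => he (by rwa [← h, prime_prime])) ?_ ?_
    · rw [pd_mono_of_notMem (by simp), mul_zero, mul_zero]
    · rw [prime_prime, pd_mono_of_notMem (by simp), mul_zero, mul_zero]

theorem topFree_le {V : Submodule F (Grassmann F n)} (hV : PoissonClosed V) (h0 : 1 ∈ V)
    (h1 : homog F n 1 ≤ V) (h2 : homog F n 2 ≤ V) (h3 : homog F n 3 ≤ V) :
    topFree F n ≤ V := by
  have h : ∀ k, k + 3 < n → homog F n (k + 3) ≤ V := by
    intro k
    induction k with
    | zero => exact fun _ => h3
    | succ k ih =>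
      intro hk
      have := homog_succ_le hV h3 (ih (by omega)) (by omega) (by omega)
      rwa [show k + 1 + 3 = k + 3 + 1 by omega]
  refine Submodule.span_le.2 ?_
  rintro _ ⟨u, hu, rfl⟩
  have hc := (Finset.card_lt_iff_ne_univ u).2 hu
  rw [Fintype.card_fin] at hc
  rcases hk : u.card with _ | _ | _ | k
  · rw [Finset.card_eq_zero.1 hk, mono_empty]
    exact h0
  · exact h1 (mono_mem_homog hk)
  · exact h2 (mono_mem_homog hk)
  · exact h k (by omega) (mono_mem_homog hk)

theorem H_le_of_homog_le [CharZero F] {N : Submodule F (Module.End F (Grassmann F n))}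
    (hN : BracketClosed N) (h1 : homog F n 1 ≤ N.comap ham) (h2 : homog F n 2 ≤ N.comap ham)
    (h3 : homog F n 3 ≤ N.comap ham) : H F n ≤ N := by
  rw [H_eq_map, Submodule.map_le_iff_le_comap]
  refine topFree_le hN.comap ?_ h1 h2 h3
  rw [Submodule.mem_comap, ham_one]
  exact zero_mem _

/-! ### Degrees one to three when some index is fixed. -/

section Odd

variable {V : Submodule F (Grassmann F n)} {z : Fin n}

/-- {ξ_iξ_z, ξ_jξ_z} = ξ_iξ_j by contraction at z; a contraction of i with j would leave ξ_z² = 0.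
-/
theorem homog_two_le_of_odd (hV : PoissonClosed V) (hz : prime z = z)
    (h : ∀ i, i ≠ z → xi F i * xi F z ∈ V) : homog F n 2 ≤ V := by
  refine homog_two_le fun i j hij => ?_
  by_cases hi : i = z
  · rw [hi, xi_mul_xi]
    exact neg_mem (h j fun hj => hij (hi.trans hj.symm))
  by_cases hj : j = z
  · exact hj ▸ h i hi
  have hi' : prime i ≠ z := fun h => hi (by rw [← hz, ← h, prime_prime])
  have := hV _ (h i hi) _ (h j hj)
  rw [poisson_pair, hz, pd_xi_mul, pd_xi_mul, pd_xi, pd_xi, if_neg hi', if_neg (Ne.symm hj),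
    if_pos rfl, mul_zero, sub_zero, zero_sub, mul_one, mul_neg, sub_neg_eq_add] at this
  split_ifs at this <;> simpa [xi_mul_self] using this

theorem homog_one_le_of_odd (hV : PoissonClosed V) (hz : prime z = z) (h2 : homog F n 2 ≤ V)
    (h : xi F z ∈ V) : homog F n 1 ≤ V := by
  refine homog_one_le fun c => ?_
  by_cases hc : c = z
  · exact hc ▸ h
  have hc' : prime c ≠ z := fun h => hc (by rw [← hz, ← h, prime_prime])
  have := hV _ (h2 (pair_mem_homog c z)) _ h
  rw [poisson_pair, hz, pd_xi, pd_xi, if_neg hc', if_pos rfl] at this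
  simpa using this

theorem triple_mem_of_odd (hV : PoissonClosed V) (hz : prime z = z) (h2 : homog F n 2 ≤ V)
    {a b c : Fin n} (ha : a ≠ z) (hb : b ≠ z) (hc : c ≠ z)
    (h : xi F a * (xi F b * xi F z) ∈ V) : xi F a * (xi F b * xi F c) ∈ V := by
  have := hV _ (h2 (pair_mem_homog c z)) _ h
  have h1 : xi F z * pd F (prime c) (xi F a * (xi F b * xi F z)) = 0 := by
    have h3 : ∀ x, xi F z * (xi F x * xi F z) = 0 := fun x => by
      rw [xi_mul_xi_mul_xi_rotate, xi_mul_self, mul_zero]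
    have hc' : prime c ≠ z := fun h => hc (by rw [← hz, ← h, prime_prime])
    rw [pd_xi_mul, pd_xi_mul, pd_xi, if_neg hc', mul_zero, sub_zero]
    split_ifs <;> simp [mul_sub, h3]
  rw [poisson_pair, h1, hz, pd_xi_mul, pd_xi_mul, pd_xi, if_neg ha.symm, if_neg hb.symm,
    if_pos rfl, mul_one] at this
  rw [← xi_mul_xi_mul_xi_rotate]
  simpa using this

theorem homog_three_le_of_odd (hV : PoissonClosed V) (hz : prime z = z) (h2 : homog F n 2 ≤ V)
    {i j : Fin n} (hi : i ≠ z) (hj : j ≠ z) (hij : i ≠ j)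
    (h : xi F i * (xi F j * xi F z) ∈ V) : homog F n 3 ≤ V := by
  have symm : ∀ {a b}, xi F a * (xi F b * xi F z) ∈ V → xi F b * (xi F a * xi F z) ∈ V :=
    fun {a b} h => by rw [xi_mul_xi_mul_xi_swap]; exact neg_mem h
  -- Replace z by c, then a by z using ξ_{a'}ξ_z. The pair {a, b} beside z becomes {b, c}, and
  -- repeating this reaches every pair.
  have move : ∀ {a b c}, a ≠ z → b ≠ z → c ≠ z → a ≠ b → a ≠ c →
      xi F a * (xi F b * xi F z) ∈ V → xi F b * (xi F c * xi F z) ∈ V := by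
    intro a b c ha hb hc hab hac h
    have h3 := triple_mem_of_odd hV hz h2 ha hb hc h
    have := hV _ (h2 (pair_mem_homog (prime a) z)) _ h3
    rw [poisson_pair, prime_prime, hz, pd_xi_mul, pd_xi_mul, pd_xi, pd_xi_mul, pd_xi_mul, pd_xi,
      if_neg ha.symm, if_neg hb.symm, if_neg hc.symm, if_pos rfl, if_neg hab, if_neg hac] at this
    rw [← xi_mul_xi_mul_xi_rotate]
    simpa using this
  have all : ∀ a b, a ≠ z → b ≠ z → a ≠ b → xi F a * (xi F b * xi F z) ∈ V := by
    intro a b ha hb hab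
    by_cases hai : a = i
    · subst hai
      by_cases hbj : b = j
      · exact hbj ▸ h
      · exact move hj ha hb hij.symm (Ne.symm hbj) (symm h)
    by_cases haj : a = j
    · subst haj
      by_cases hbi : b = i
      · exact hbi ▸ symm h
      · exact move hi ha hb hij (Ne.symm hbi) h
    have h4 := move hi hj ha hij (Ne.symm hai) h
    by_cases hbj : b = j
    · exact hbj ▸ symm h4
    · exact move hj ha hb (Ne.symm haj) (Ne.symm hbj) h4
  refine homog_three_le fun a b c hab hac hbc => ?_
  by_cases ha : a = z
  · subst ha
    rw [xi_mul_xi_mul_xi_rotate]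
    exact all b c hab.symm hac.symm hbc
  by_cases hb : b = z
  · subst hb
    rw [← xi_mul_xi_mul_xi_rotate]
    exact all c a hbc.symm hab (Ne.symm hac)
  by_cases hc : c = z
  · exact hc ▸ all a b ha hb hab
  · exact triple_mem_of_odd hV hz h2 ha hb hc (all a b ha hb hab)

end Odd

theorem exists_ne_four (hn : 5 ≤ n) (a b c d : Fin n) : ∃ x, x ≠ a ∧ x ≠ b ∧ x ≠ c ∧ x ≠ d := by
  obtain ⟨x, hx⟩ : ∃ x, x ∉ ({a, b, c, d} : Finset (Fin n)) := by
    by_contra h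
    push Not at h
    have h1 := Finset.card_le_four (a := a) (b := b) (c := c) (d := d)
    rw [Finset.eq_univ_of_forall h, Finset.card_univ, Fintype.card_fin] at h1
    omega
  exact ⟨x, by simpa using hx⟩

/-! ### Degrees one to three from a pair z, z' in place of a fixed index. -/

section Even

variable {V : Submodule F (Grassmann F n)}

theorem homog_two_le_of_even [CharZero F] (hV : PoissonClosed V) (hn : 5 ≤ n)
    (z : Fin n)
    (h : ∀ e j, e = z ∨ e = prime z → j ≠ z → j ≠ prime z → xi F e * xi F j ∈ V) :
    homog F n 2 ≤ V := by
  have hprime : ∀ {i}, i ≠ z → i ≠ prime z → prime i ≠ z ∧ prime i ≠ prime z := fun h1 h2 =>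
    ⟨fun h => h2 (prime_eq_iff.1 h), fun h => h1 (prime_injective h)⟩
  -- This is {ξ_zξ_i, ξ_{z'}ξ_j}: the contraction of z with z' gives ξ_iξ_j, and that of i with j,
  -- present only for j = i', gives ξ_zξ_{z'}.
  have key : ∀ i j, i ≠ z → i ≠ prime z → j ≠ z → j ≠ prime z →
      xi F i * xi F j + (if prime i = j then xi F z * xi F (prime z) else 0) ∈ V := by
    intro i j hi hi' hj hj'
    have := hV _ (h z i (Or.inl rfl) hi hi') _ (h (prime z) j (Or.inr rfl) hj hj')
    rw [poisson_pair, pd_xi_mul, pd_xi_mul, pd_xi, pd_xi, if_pos rfl, if_neg hj'.symm,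
      if_neg (hprime hi hi').2] at this
    split_ifs at this ⊢ <;> simpa using this
  -- Adding `key` for (i, i') and (i', i) cancels ξ_iξ_{i'} and leaves 2ξ_zξ_{z'}.
  have hzz : xi F z * xi F (prime z) ∈ V := by
    obtain ⟨i, hi, hi', -, -⟩ := exists_ne_four hn z (prime z) z z
    have h1 := key i (prime i) hi hi' (hprime hi hi').1 (hprime hi hi').2
    have h2 := key (prime i) i (hprime hi hi').1 (hprime hi hi').2 hi hi'
    rw [if_pos rfl] at h1
    rw [prime_prime, if_pos rfl, xi_mul_xi] at h2
    have h3 := add_mem h1 h2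
    have h4 : xi F i * xi F (prime i) + xi F z * xi F (prime z) +
        (-(xi F i * xi F (prime i)) + xi F z * xi F (prime z)) =
        (2 : F) • (xi F z * xi F (prime z)) := by
      rw [two_smul]
      abel
    rw [h4] at h3
    exact (Submodule.smul_mem_iff _ two_ne_zero).1 h3
  have hzj : ∀ e j, e = z ∨ e = prime z → e ≠ j → xi F e * xi F j ∈ V := by
    intro e j he hej
    by_cases hj : j = z
    · subst hj
      rw [he.resolve_left hej, xi_mul_xi]
      exact neg_mem hzz
    by_cases hj' : j = prime z
    · subst hj'
      rwa [he.resolve_right hej]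
    exact h e j he hj hj'
  refine homog_two_le fun i j hij => ?_
  by_cases hi : i = z ∨ i = prime z
  · exact hzj i j hi hij
  by_cases hj : j = z ∨ j = prime z
  · rw [xi_mul_xi]
    exact neg_mem (hzj j i hj hij.symm)
  push Not at hi hj
  have := key i j hi.1 hi.2 hj.1 hj.2
  split_ifs at this
  · exact (Submodule.add_mem_iff_left _ hzz).1 this
  · simpa using this

/-- {ξ_{a'}ξ_b, ξ_a} = ξ_b for b ≠ a'. The index z' is thus not reached from z in one step, but
through a third index. -/
theorem homog_one_le_of_even (hV : PoissonClosed V) (hn : 5 ≤ n)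
    (h2 : homog F n 2 ≤ V) {z : Fin n} (h : xi F z ∈ V) :
    homog F n 1 ≤ V := by
  have move : ∀ a b, xi F a ∈ V → b ≠ prime a → xi F b ∈ V := by
    intro a b ha hb
    have hb' : prime b ≠ a := fun h => hb (prime_eq_iff.1 h)
    have := hV _ (h2 (pair_mem_homog (prime a) b)) _ ha
    rw [poisson_pair, prime_prime, pd_xi, pd_xi, if_pos rfl, if_neg hb'] at this
    simpa using this
  refine homog_one_le fun c => ?_
  by_cases hc : c = prime z
  · subst hc
    obtain ⟨i, hi, hi', -, -⟩ := exists_ne_four hn z (prime z) z z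
    exact move i _ (move z i h hi') fun h => hi (prime_injective h).symm
  · exact move z c h hc

/-- Quadrics act by replacing indices: `move` changes the single index of ξ_aξ_bξ_{b'}, `split`
breaks the pair b, b', and `shift` exchanges it for another pair. The argument includes n = 6: the
cubics are then reducible over so(6), but this monomial still generates all of them. -/
theorem homog_three_le_of_even (hV : PoissonClosed V) (hn : 5 ≤ n)
    (hp : ∀ i : Fin n, prime i ≠ i) (h2 : homog F n 2 ≤ V) {i j : Fin n} (hij : i ≠ j)
    (hij' : i ≠ prime j) (h : xi F i * (xi F j * xi F (prime j)) ∈ V) : homog F n 3 ≤ V := by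
  have hpair : ∀ a b, xi F a * xi F b ∈ V := fun a b =>
    h2 (pair_mem_homog a b)
  have hpr : ∀ {a b : Fin n}, a ≠ prime b → prime a ≠ b := fun h h' => h (prime_eq_iff.1 h')
  have move : ∀ {a b q}, a ≠ b → a ≠ prime b → q ≠ prime a → q ≠ b → q ≠ prime b →
      xi F a * (xi F b * xi F (prime b)) ∈ V → xi F q * (xi F b * xi F (prime b)) ∈ V := by
    intro a b q hab hab' hqa hqb hqb' h
    have := hV _ (hpair (prime a) q) _ h
    rw [poisson_pair, prime_prime, pd_xi_mul, pd_xi_mul, pd_xi, pd_xi_mul, pd_xi_mul, pd_xi,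
      if_pos rfl, if_neg hab, if_neg hab', if_neg (hpr hqa), if_neg (hpr hqb'),
      if_neg (prime_injective.ne hqb)] at this
    simpa using this
  have split : ∀ {a b q}, a ≠ b → a ≠ prime b → q ≠ prime a → q ≠ prime b →
      xi F a * (xi F b * xi F (prime b)) ∈ V → xi F a * (xi F b * xi F q) ∈ V := by
    intro a b q hab hab' hqa hqb' h
    have := hV _ (hpair b q) _ h
    rw [poisson_pair, pd_xi_mul, pd_xi_mul, pd_xi, pd_xi_mul, pd_xi_mul, pd_xi, if_pos rfl,
      if_neg (Ne.symm hab'), if_neg (hp b), if_neg (hpr hqa), if_neg (hpr hqb')] at this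
    have h0 : xi F b * (xi F a * xi F b) = 0 := by
      rw [xi_mul_xi_mul_xi_rotate, xi_mul_self, mul_zero]
    have h1 : xi F q * (xi F a * xi F b) = xi F a * (xi F b * xi F q) :=
      xi_mul_xi_mul_xi_rotate q a b
    split_ifs at this <;> simpa [h0, h1] using this
  have shift : ∀ {a b q}, a ≠ b → a ≠ prime b → q ≠ a → q ≠ prime a → q ≠ b → q ≠ prime b →
      xi F a * (xi F b * xi F (prime b)) ∈ V → xi F a * (xi F q * xi F (prime q)) ∈ V := by
    intro a b q hab hab' hqa hqa' hqb hqb' h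
    have := hV _ (hpair (prime b) (prime q)) _ (split hab hab' hqa' hqb' h)
    have e : poisson (xi F (prime b) * xi F (prime q)) (xi F a * (xi F b * xi F q)) =
        -(xi F (prime q) * (xi F a * xi F q)) - xi F (prime b) * (xi F a * xi F b) := by
      rw [poisson_pair, prime_prime, prime_prime, pd_xi_mul, pd_xi_mul, pd_xi, pd_xi_mul,
        pd_xi_mul, pd_xi, if_neg hab.symm, if_pos rfl, if_neg hqb.symm, if_neg hqa, if_neg hqb,
        if_pos rfl]
      simp
    rw [e, xi_mul_xi_mul_xi_rotate (prime q) a q, xi_mul_xi_mul_xi_rotate (prime b) a b] at this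
    exact neg_mem_iff.1 ((Submodule.sub_mem_iff_left _ h).1 this)
  have allA : ∀ {a b}, a ≠ b → a ≠ prime b → xi F a * (xi F b * xi F (prime b)) ∈ V →
      ∀ x, x ≠ b → x ≠ prime b → xi F x * (xi F b * xi F (prime b)) ∈ V := by
    intro a b hab hab' h x hx hx'
    -- `move` cannot go directly from a to a', so a detour through a further index q is made.
    by_cases hxa : x = prime a
    · obtain ⟨q, h1, h2, h3, h4⟩ := exists_ne_four hn a (prime a) b (prime b)
      exact move h3 h4 (fun h => h1 (prime_injective (h.symm.trans hxa))) hx hx'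
        (move hab hab' h2 h3 h4 h)
    · exact move hab hab' hxa hx hx' h
  have all : ∀ b x, x ≠ b → x ≠ prime b → xi F x * (xi F b * xi F (prime b)) ∈ V := by
    intro b x hx hx'
    by_cases hbj : b = j
    · subst hbj
      exact allA hij hij' h x hx hx'
    by_cases hbj' : b = prime j
    · subst hbj'
      rw [prime_prime] at hx' ⊢
      rw [xi_mul_xi, mul_neg]
      exact neg_mem (allA hij hij' h x hx' hx)
    · obtain ⟨q, h1, h2, h3, h4⟩ := exists_ne_four hn j (prime j) b (prime b)
      exact allA h3 h4 (shift h1 h2 h3.symm (fun h => h4 (by rw [h, prime_prime])) hbj hbj'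
        (allA hij hij' h q h1 h2)) x hx hx'
  refine homog_three_le fun a b c hab hac hbc => ?_
  by_cases h1 : a = prime b
  · subst h1
    rw [xi_mul_xi_mul_xi_swap, ← xi_mul_xi_mul_xi_rotate c b (prime b)]
    exact neg_mem (all b c hbc.symm hac.symm)
  by_cases h3 : c = prime a
  · subst h3
    rw [xi_mul_xi_mul_xi_swap]
    exact neg_mem (all a b hab.symm hbc)
  by_cases h4 : c = prime b
  · subst h4
    exact all b a hab h1
  · exact split hab h1 h3 h4 (all b a hab h1)

end Even

end Generation

/-! ### The algebra H(n) in odd and even dimension. -/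

section TypeH

variable {F : Type*} [Field F] {n : ℕ}

theorem hamDiag_injective : Function.Injective (hamDiag (n := n)) := by
  intro i j h
  have hi := i.2
  have hj := j.2
  refine Fin.ext ?_
  simp only [hamDiag] at h
  split_ifs at h <;> omega

variable [CharZero F]

theorem hasCartanGenerators_H_odd (hn : 5 ≤ n) (hodd : n % 2 = 1) :
    HasCartanGenerators 1 (H F n) (Hdeg F n (-1)) (Hdeg F n 0) (Hdeg F n 1) (cartanH F n) := by
  classical
  obtain ⟨z, hzv⟩ : ∃ z : Fin n, z.val = n - 1 := ⟨⟨n - 1, by omega⟩, rfl⟩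
  obtain ⟨i, hi⟩ : ∃ i : Fin n, i.val = 0 := ⟨⟨0, by omega⟩, rfl⟩
  obtain ⟨j, hj⟩ : ∃ j : Fin n, j.val = 1 := ⟨⟨1, by omega⟩, rfl⟩
  have hz : prime z = z := Fin.ext (by rw [prime_val]; split_ifs <;> omega)
  have hij : i ≠ j := fun h => by rw [h] at hi; omega
  have hiz : i ≠ z := fun h => by rw [h] at hi; omega
  have hjz : j ≠ z := fun h => by rw [h] at hj; omega
  have hdz : hamDiag z = 0 := by simp only [hamDiag]; split_ifs <;> omega
  have hdi : hamDiag i = 10 * n := by simp only [hamDiag]; split_ifs <;> omega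
  have hdj : hamDiag j = n + 1 := by simp only [hamDiag]; split_ifs <;> omega
  -- The fixed index contributes 0, so the quadrics take the distinct nonzero values of their other
  -- index, `x₋₁` takes 0, and the cubic takes 11n + 1, beyond the bound 10n for all entries.
  have hw : ∀ k : {k // k ≠ z}, ∑ i ∈ {k.1, z}, hamDiag i = hamDiag k.1 := fun k => by
    rw [Finset.sum_pair k.2, hdz, add_zero]
  have hsum : ∑ i ∈ {i, j, z}, hamDiag i = 11 * n + 1 := by
    rw [Finset.sum_insert (by simp [hij, hiz]), Finset.sum_pair hjz, hdi, hdj, hdz]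
    ring
  have hbound : ∀ k : Fin n, hamDiag k ≤ 10 * n := fun k => by
    have := k.2
    simp only [hamDiag]
    split_ifs <;> omega
  refine hasCartanGenerators_of (fun k : {k // k ≠ z} => ∑ i ∈ {k.1, z}, coordOn (cartanH F n) i)
    (fun k => ham (mono F {k.1, z})) _ (ham (mono F {z})) _ (fun _ => ham (mono F {i, j, z})) ∅
    (isWeightVector_ham_mono (by simp) le_rfl)
    (fun _ => isWeightVector_ham_mono ?_ (by norm_num))
    (fun k h => bracket_ham_mono h _) (fun k => ham_mono_mem_Hdeg ?_)
    ⟨hamField F n, hamField_mem⟩ (fun k => ∑ i ∈ {k.1, z}, hamDiag i) (∑ i ∈ {z}, hamDiag i)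
    (fun _ => ∑ i ∈ {i, j, z}, hamDiag i) (fun k => sum_coordOn_hamField _)
    (sum_coordOn_hamField _) (fun _ => sum_coordOn_hamField _) ?_
    (fun _ _ _ => Subsingleton.elim _ _) ?_ ?_ ?_
    bracketClosed_Hdeg_zero bracketClosed_H cartanH_le_Hdeg (Hdeg_le_H (by omega) (by omega))
    (Hdeg_le_H le_rfl (by omega)) (Hdeg_le_H (by omega) (by omega)) ?_ ?_
  · rw [Finset.card_insert_of_notMem (by simp [hij, hiz]), Finset.card_pair hjz]
    rfl
  · rw [Finset.card_pair k.2]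
    rfl
  · intro k l h
    beta_reduce at h
    rw [hw, hw] at h
    exact Subtype.ext (hamDiag_injective h)
  · intro _
    rw [hsum, Finset.sum_singleton, hdz]
    omega
  · intro k
    rw [hw, Finset.sum_singleton]
    exact hamDiag_injective.ne k.2
  · intro k _
    rw [hw, hsum]
    have := hbound k
    omega
  · intro h _ N hN _ hstar
    rw [Hdeg_eq_map (k := 2) rfl, Submodule.map_le_iff_le_comap]
    exact homog_two_le_of_odd hN.comap hz fun k hk => pair_mem_of_mono_mem (hstar ⟨k, hk⟩)
  · intro N hN h0 hx hy
    rw [Hdeg_eq_map (k := 2) rfl, Submodule.map_le_iff_le_comap] at h0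
    refine H_le_of_homog_le hN (homog_one_le_of_odd hN.comap hz h0 ?_) h0
      (homog_three_le_of_odd hN.comap hz h0 hiz hjz hij (triple_mem_of_mono_mem (hy 0)))
    simpa using hx

theorem hasCartanGenerators_H_even {r : ℕ} (hr : 0 < r) (hr2 : r ≤ 2) (hn : 5 ≤ n)
    (heven : n % 2 = 0) :
    HasCartanGenerators r (H F n) (Hdeg F n (-1)) (Hdeg F n 0) (Hdeg F n 1) (cartanH F n) := by
  classical
  obtain ⟨z, hz⟩ : ∃ z : Fin n, z.val = 0 := ⟨⟨0, by omega⟩, rfl⟩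
  obtain ⟨i, hi⟩ : ∃ i : Fin n, i.val = 1 := ⟨⟨1, by omega⟩, rfl⟩
  obtain ⟨j, hj⟩ : ∃ j : Fin n, j.val = 2 := ⟨⟨2, by omega⟩, rfl⟩
  have hp : ∀ k : Fin n, prime k ≠ k := fun k h => by
    have h1 := congrArg Fin.val h
    have := k.2
    rw [prime_val] at h1
    split_ifs at h1 <;> omega
  have hpj : (prime j).val = 2 + n / 2 := by rw [prime_val, hj, if_pos (by omega)]
  have hzi : z ≠ i := fun h => by rw [h] at hz; omega
  have hzj : z ≠ j := fun h => by rw [h] at hz; omega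
  have hij : i ≠ j := fun h => by rw [h] at hi; omega
  have hij' : i ≠ prime j := fun h => by rw [h] at hi; omega
  have hdz : hamDiag z = 10 * n := by simp only [hamDiag]; split_ifs <;> omega
  have hdi : hamDiag i = n + 1 := by simp only [hamDiag]; split_ifs <;> omega
  have hdj : hamDiag j = n + 2 := by simp only [hamDiag]; split_ifs <;> omega
  -- The entries at z and z' are ±10n, all others lie between n and 3n/2 in absolute value. A sum of
  -- one of each kind therefore determines both indices and avoids 10n, n + 1 and 12n + 3.
  have hbound : ∀ k : Fin n, k ≠ z → k ≠ prime z →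
      (n < hamDiag k ∧ 2 * hamDiag k < 3 * n) ∨ (hamDiag k < -n ∧ -(3 * n) < 2 * hamDiag k) := by
    intro k hk hk'
    have h1 := k.2
    have h2 : k.val ≠ 0 := fun h => hk (Fin.ext (h.trans hz.symm))
    have h3 : k.val ≠ n / 2 := fun h => hk' (Fin.ext (by
      rw [prime_val, hz, if_pos (by omega), h, zero_add]))
    simp only [hamDiag]
    split_ifs <;> omega
  let κ := {p : Fin n × Fin n // (p.1 = z ∨ p.1 = prime z) ∧ p.2 ≠ z ∧ p.2 ≠ prime z}
  have hκ : ∀ k : κ, k.1.1 ≠ k.1.2 := fun k h => by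
    rcases k.2.1 with h1 | h1
    · exact k.2.2.1 (h ▸ h1)
    · exact k.2.2.2 (h ▸ h1)
  have hw : ∀ k : κ, ∑ i ∈ {k.1.1, k.1.2}, hamDiag i = hamDiag k.1.1 + hamDiag k.1.2 := fun k =>
    Finset.sum_pair (hκ k)
  have hd1 : ∀ k : κ, hamDiag k.1.1 = 10 * n ∨ hamDiag k.1.1 = -(10 * n) := fun k => by
    rcases k.2.1 with h1 | h1 <;> rw [h1]
    · exact Or.inl hdz
    · right
      rw [hamDiag_prime, hdz]
  -- The monomial ξ_iξ_jξ_{j'} alone generates the cubics; the second one, present for r = 2, is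
  -- chosen so that its weight is new.
  let u : Fin r → Finset (Fin n) := fun s => if s.val = 0 then {i, j, prime j} else {z, i, j}
  have hu : ∀ s, (u s).card = 3 := fun s => by
    simp only [u]
    split_ifs
    · rw [Finset.card_insert_of_notMem (by simp [hij, hij']), Finset.card_pair (hp j).symm]
    · rw [Finset.card_insert_of_notMem (by simp [hzi, hzj]), Finset.card_pair hij]
  have hus : ∀ s, ∑ k ∈ u s, hamDiag k = if s.val = 0 then (n + 1 : ℤ) else 12 * n + 3 := fun s => by
    simp only [u]
    split_ifs
    · rw [Finset.sum_insert (by simp [hij, hij']), Finset.sum_pair (hp j).symm, hamDiag_prime, hdi]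
      ring
    · rw [Finset.sum_insert (by simp [hzi, hzj]), Finset.sum_pair hij, hdz, hdi, hdj]
      ring
  refine hasCartanGenerators_of (fun k : κ => ∑ i ∈ {k.1.1, k.1.2}, coordOn (cartanH F n) i)
    (fun k => ham (mono F {k.1.1, k.1.2})) _ (ham (mono F {z})) _ (fun s => ham (mono F (u s))) ∅
    (isWeightVector_ham_mono (by simp) le_rfl)
    (fun s => isWeightVector_ham_mono (by rw [hu]; rfl) (by norm_num))
    (fun k h => bracket_ham_mono h _) (fun k => ham_mono_mem_Hdeg ?_)
    ⟨hamField F n, hamField_mem⟩ (fun k => ∑ i ∈ {k.1.1, k.1.2}, hamDiag i)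
    (∑ i ∈ {z}, hamDiag i)
    (fun s => ∑ i ∈ u s, hamDiag i) (fun k => sum_coordOn_hamField _)
    (sum_coordOn_hamField _) (fun _ => sum_coordOn_hamField _) ?_ ?_ ?_ ?_ ?_
    bracketClosed_Hdeg_zero bracketClosed_H cartanH_le_Hdeg (Hdeg_le_H (by omega) (by omega))
    (Hdeg_le_H le_rfl (by omega)) (Hdeg_le_H (by omega) (by omega)) ?_ ?_
  · rw [Finset.card_pair (hκ k)]
    rfl
  · intro k l h
    beta_reduce at h
    rw [hw, hw] at h
    have hk2 := hbound _ k.2.2.1 k.2.2.2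
    have hl2 := hbound _ l.2.2.1 l.2.2.2
    have hk1 := hd1 k
    have hl1 := hd1 l
    have h1 : hamDiag k.1.1 = hamDiag l.1.1 := by omega
    have h2 : hamDiag k.1.2 = hamDiag l.1.2 := by omega
    exact Subtype.ext (Prod.ext (hamDiag_injective h1) (hamDiag_injective h2))
  · intro s t h
    beta_reduce at h
    rw [hus, hus] at h
    have := s.2
    have := t.2
    refine Fin.ext ?_
    split_ifs at h <;> omega
  · intro s
    rw [hus, Finset.sum_singleton, hdz]
    split_ifs <;> omega
  · intro k
    rw [hw, Finset.sum_singleton, hdz]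
    have hk2 := hbound _ k.2.2.1 k.2.2.2
    have hk1 := hd1 k
    omega
  · intro k s
    rw [hw, hus]
    have hk2 := hbound _ k.2.2.1 k.2.2.2
    have hk1 := hd1 k
    split_ifs <;> omega
  · intro h _ N hN _ hstar
    rw [Hdeg_eq_map (k := 2) rfl, Submodule.map_le_iff_le_comap]
    exact homog_two_le_of_even hN.comap hn z fun e k he hk hk' =>
      pair_mem_of_mono_mem (hstar ⟨(e, k), he, hk, hk'⟩)
  · intro N hN h0 hx hy
    rw [Hdeg_eq_map (k := 2) rfl, Submodule.map_le_iff_le_comap] at h0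
    refine H_le_of_homog_le hN (homog_one_le_of_even hN.comap hn h0 (z := z) ?_) h0
      (homog_three_le_of_even hN.comap hn hp h0 hij hij'
        (triple_mem_of_mono_mem (by simpa [u] using hy ⟨0, hr⟩)))
    simpa using hx

end TypeH

end CartanSuper

end

theorem mainTheorem3 (F : Type*) [Field F] [IsAlgClosed F] [CharZero F] :
    (∀ n : ℕ, 3 ≤ n → CartanSuper.HasCartanGenerators 1 (CartanSuper.W F n)
      (CartanSuper.Wdeg F n (-1)) (CartanSuper.Wdeg F n 0) (CartanSuper.Wdeg F n (n - 1))
      (CartanSuper.cartanW F n)) ∧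
    (∀ n : ℕ, 4 ≤ n → CartanSuper.HasCartanGenerators 1 (CartanSuper.S F n)
      (CartanSuper.Sdeg F n (-1)) (CartanSuper.Sdeg F n 0) (CartanSuper.Sdeg F n (n - 2))
      (CartanSuper.cartanS F n)) ∧
    (∀ m : ℕ, 2 ≤ m → CartanSuper.HasCartanGenerators 1 (CartanSuper.St F m)
      (CartanSuper.Stdeg F m (-1)) (CartanSuper.Stdeg F m 0) (CartanSuper.Stdeg F m 1)
      (CartanSuper.cartanS F (2 * m))) ∧
    (∀ n : ℕ, 5 ≤ n → CartanSuper.HasCartanGenerators (if n = 6 then 2 else 1)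
      (CartanSuper.H F n) (CartanSuper.Hdeg F n (-1)) (CartanSuper.Hdeg F n 0)
      (CartanSuper.Hdeg F n 1) (CartanSuper.cartanH F n)) := by
  refine ⟨fun n hn => CartanSuper.hasCartanGenerators_W hn,
    fun n hn => CartanSuper.hasCartanGenerators_S hn,
    fun m hm => CartanSuper.hasCartanGenerators_St hm, fun n hn => ?_⟩
  rcases Nat.mod_two_eq_zero_or_one n with h | h
  -- The even case allows one or two vectors `y_i`, which covers n = 6 along with the rest.
  · exact CartanSuper.hasCartanGenerators_H_even (by split_ifs <;> omega)
      (by split_ifs <;> omega) hn h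
  · rw [if_neg (by omega)]
    exact CartanSuper.hasCartanGenerators_H_odd hn h
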